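/- Theorem (Algebraic Poincaré lemma). Let $n\ge 1$ and $m\ge 0$ be integers and let $E=\mathbb R^n\times\mathbb R^m\to\mathbb R^n$ be the trivial bundle, with base coordinates $x^\mu$ ($0\le\mu\le n-1$) and fiber coordinates $\phi^i$ ($1\le i\le m$). The jet space $J^k(E)$ is the Euclidean space with coordinates $x^\mu$ and $\phi^i_I$, where $I$ runs over the symmetric multi-indices of length $|I|\le k$ in the indices $0,\dots,n-1$ and $\phi^i_\emptyset=\phi^i$. A local function is a (real-valued) smooth function on $J^k(E)$ for some finite $k$. On local functions define the total derivatives and the Euler–Lagrange derivatives $$\partial_\nu=\frac{\partial}{\partial x^\nu}+\sum_{i,I}\phi^i_{I\nu}\frac{\partial}{\partial\phi^i_I},\qquad \frac{\delta f}{\delta\phi^i}=\sum_I(-1)^{|I|}\,\partial_I\frac{\partial f}{\partial\phi^i_I},$$ where $I\nu$ is $I$ with the index $\nu$ added and $\partial_I=\partial_{\mu_1}\cdots\partial_{\mu_l}$ for $I=\mu_1\cdots\mu_l$. Let $\Omega^p$ be the real vector space of horizontal $p$-forms $\omega=\sum_{\mu_1<\dots<\mu_p}\omega_{\mu_1\dots\mu_p}\,dx^{\mu_1}\wedge\dots\wedge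 dx^{\mu_p}$ with local functions $\omega_{\mu_1\dots\mu_p}$ as coefficients, let $d_H:\Omega^p\to\Omega^{p+1}$, $d_H\omega=dx^\mu\wedge\partial_\mu\omega$, be the horizontal differential (so $d_H^2=0$), and let $H^p(d_H)=\ker(d_H|_{\Omega^p})/d_H\Omega^{p-1}$, with $\Omega^{-1}=0$. For a top form $\omega=L\,dx^0\wedge\dots\wedge dx^{n-1}$ put $\frac{\delta\omega}{\delta\phi^i}=\frac{\delta L}{\delta\phi^i}$. Then: 1. $H^0(d_H)\cong\mathbb R$, by the isomorphism that sends the class of the constant function $c$ to $c$. 2. $H^p(d_H)=0$ for $0<p<n$. 3. Every $n$-form is $d_H$-closed. For $\omega,\omega'\in\Omega^n$ there is $j\in\Omega^{n-1}$ with $\omega=\omega'+d_Hj$ if and only if $\frac{\delta}{\delta\phi^i}(\omega-\omega')=0$ for all $i$. Consequently the identity of $\Omega^n$ induces a linear isomorphism $H^n(d_H)\cong\Omega^n\big/\{\omega\in\Omega^n:\ \frac{\delta\omega}{\delta\phi^i}=0\text{ for all }i\}$. -/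

import Mathlib

noncomputable section

namespace HorizontalComplex

section LocalFunctions

open scoped ContDiff

/-- Multi-indices `I = (I_0, …, I_{n-1})`. `I μ` is the number of times `μ` occurs among the
(unordered) derivative indices, so `φ^i_I` is the symmetric coordinate `φ^i_{μ_1 … μ_l}`. -/
abbrev MultiIndex (n : ℕ) : Type := Fin n → ℕ

/-- The length `|I|` of a multi-index. -/
def MultiIndex.length {n : ℕ} (I : MultiIndex n) : ℕ := ∑ μ, I μ

/-- The multi-index `Iν`, with one more occurrence of `ν`. -/
def MultiIndex.append {n : ℕ} (I : MultiIndex n) (ν : Fin n) : MultiIndex n := I + Pi.single ν 1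

/-- The finite set of multi-indices of length at most `k`. -/
def multiIndices (n k : ℕ) : Finset (MultiIndex n) :=
  (Fintype.piFinset fun _ => Finset.range (k + 1)).filter fun I => I.length ≤ k

theorem mem_multiIndices {n k : ℕ} {I : MultiIndex n} : I ∈ multiIndices n k ↔ I.length ≤ k := by
  simp only [multiIndices, Finset.mem_filter, Fintype.mem_piFinset, Finset.mem_range,
    and_iff_right_iff_imp]
  intro h μ
  have : I μ ≤ I.length :=
    Finset.single_le_sum (f := I) (fun _ _ => Nat.zero_le _) (Finset.mem_univ μ)
  omega

/-- The jet space `J^k(E) = ℝⁿ × V^k` of the trivial bundle `E = ℝⁿ × ℝᵐ`, with coordinates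
`x^μ` and `φ^i_I`, `|I| ≤ k`. -/
abbrev FiniteJet (n m k : ℕ) : Type := (Fin n → ℝ) × (Fin m × multiIndices n k → ℝ)

/-- The infinite jet space, with coordinates `x^μ` and `φ^i_I` for all multi-indices `I`. -/
abbrev Jet (n m : ℕ) : Type := (Fin n → ℝ) × (Fin m × MultiIndex n → ℝ)

/-- The projection of the infinite jet space onto `J^k(E)`. -/
def truncate (n m k : ℕ) : Jet n m →ₗ[ℝ] FiniteJet n m k where
  toFun z := (z.1, fun a => z.2 (a.1, a.2))
  map_add' _ _ := rfl
  map_smul' _ _ := rfl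

/-- `f` is (the pullback of) a smooth function on `J^k(E)`. -/
def HasOrder {n m : ℕ} (k : ℕ) (f : Jet n m → ℝ) : Prop :=
  ∃ g : FiniteJet n m k → ℝ, ContDiff ℝ ∞ g ∧ ∀ z, f z = g (truncate n m k z)

theorem multiIndices_mono {n k l : ℕ} (h : k ≤ l) : multiIndices n k ⊆ multiIndices n l :=
  fun _ hI => mem_multiIndices.2 ((mem_multiIndices.1 hI).trans h)

theorem HasOrder.mono {n m k l : ℕ} {f : Jet n m → ℝ} (hf : HasOrder k f) (h : k ≤ l) :
    HasOrder l f := by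
  obtain ⟨g, hg, hfg⟩ := hf
  refine ⟨fun y => g (y.1, fun a => y.2 (a.1, ⟨a.2.1, multiIndices_mono h a.2.2⟩)), ?_, hfg⟩
  exact hg.comp (by fun_prop)

/-- Local functions: smooth functions on `J^k(E)` for some `k`. -/
def localFunctions (n m : ℕ) : Subalgebra ℝ (Jet n m → ℝ) where
  carrier := {f | ∃ k, HasOrder k f}
  mul_mem' := by
    rintro f f' ⟨k, hk⟩ ⟨l, hl⟩
    obtain ⟨g, hg, hfg⟩ := hk.mono (le_max_left k l)
    obtain ⟨g', hg', hfg'⟩ := hl.mono (le_max_right k l)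
    exact ⟨max k l, fun y => g y * g' y, hg.mul hg', fun z => by simp [hfg, hfg']⟩
  add_mem' := by
    rintro f f' ⟨k, hk⟩ ⟨l, hl⟩
    obtain ⟨g, hg, hfg⟩ := hk.mono (le_max_left k l)
    obtain ⟨g', hg', hfg'⟩ := hl.mono (le_max_right k l)
    exact ⟨max k l, fun y => g y + g' y, hg.add hg', fun z => by simp [hfg, hfg']⟩
  algebraMap_mem' c := ⟨0, fun _ => c, contDiff_const, fun _ => rfl⟩

/-- The algebra of local functions. -/
abbrev LocalFunction (n m : ℕ) : Type := localFunctions n m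

instance (n m : ℕ) : AddCommGroup (LocalFunction n m) := Ring.toAddCommGroup

instance (n m : ℕ) : AddCommMonoid (LocalFunction n m) := AddCommGroup.toAddCommMonoid

instance (n m : ℕ) : Module ℝ (LocalFunction n m) := Algebra.toModule

/-- Evaluation of local functions at a point of the jet space. -/
def evalAt {n m : ℕ} (z : Jet n m) : LocalFunction n m →ₐ[ℝ] ℝ :=
  (Pi.evalAlgHom ℝ (fun _ : Jet n m => ℝ) z).comp (localFunctions n m).val

theorem lineDeriv_of_eq {n m k : ℕ} {f : Jet n m → ℝ} {g : FiniteJet n m k → ℝ}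
    (hg : ContDiff ℝ ∞ g) (hfg : ∀ z, f z = g (truncate n m k z)) (z v : Jet n m) :
    HasLineDerivAt ℝ f (fderiv ℝ g (truncate n m k z) (truncate n m k v)) z v := by
  have h := ((hg.differentiable (by simp)) (truncate n m k z)).hasFDerivAt.hasLineDerivAt
    (truncate n m k v)
  unfold HasLineDerivAt at h ⊢
  convert h using 2 with t
  simp [hfg]

/-- The derivative of local functions in a fixed direction of the jet space. -/
def directional {n m : ℕ} (v : Jet n m) : LocalFunction n m →ₗ[ℝ] LocalFunction n m where
  toFun f := ⟨fun z => lineDeriv ℝ f.1 z v, by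
    obtain ⟨k, g, hg, hfg⟩ := f.2
    refine ⟨k, fun y => fderiv ℝ g y (truncate n m k v), ?_,
      fun z => (lineDeriv_of_eq hg hfg z v).lineDeriv⟩
    exact (hg.fderiv_right (m := ∞) (by simp)).clm_apply contDiff_const⟩
  map_add' f f' := by
    ext z
    obtain ⟨k, g, hg, hfg⟩ := f.2
    obtain ⟨l, g', hg', hfg'⟩ := f'.2
    exact (HasDerivAt.add (lineDeriv_of_eq hg hfg z v) (lineDeriv_of_eq hg' hfg' z v)).deriv.trans
      (by rw [← (lineDeriv_of_eq hg hfg z v).lineDeriv, ← (lineDeriv_of_eq hg' hfg' z v).lineDeriv]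
          rfl)
  map_smul' c f := by
    ext z
    obtain ⟨k, g, hg, hfg⟩ := f.2
    exact (HasDerivAt.const_mul c (lineDeriv_of_eq hg hfg z v)).deriv.trans
      (by rw [← (lineDeriv_of_eq hg hfg z v).lineDeriv]; rfl)

/-- `∂/∂x^μ` on local functions. -/
def partialX {n m : ℕ} (μ : Fin n) : LocalFunction n m →ₗ[ℝ] LocalFunction n m :=
  directional (Pi.single μ 1, 0)

/-- `∂/∂φ^i_I` on local functions. -/
def partialPhi {n m : ℕ} (i : Fin m) (I : MultiIndex n) :
    LocalFunction n m →ₗ[ℝ] LocalFunction n m :=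
  directional (0, Pi.single (i, I) 1)

/-- The coordinate `φ^i_I` as a local function. -/
def phi {n m : ℕ} (i : Fin m) (I : MultiIndex n) : LocalFunction n m :=
  ⟨fun z => z.2 (i, I), I.length, fun y => y.2 (i, ⟨I, mem_multiIndices.2 le_rfl⟩),
    by fun_prop, fun _ => rfl⟩

theorem partialPhi_eq_zero {n m k : ℕ} {f : LocalFunction n m} (hf : HasOrder k f.1) (i : Fin m)
    {I : MultiIndex n} (hI : k < I.length) : partialPhi i I f = 0 := by
  obtain ⟨g, hg, hfg⟩ := hf
  ext z
  have h := (lineDeriv_of_eq hg hfg z (0, Pi.single (i, I) 1)).lineDeriv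
  have h0 : truncate n m k (0, Pi.single (i, I) 1) = 0 := by
    refine Prod.ext rfl (funext fun a => ?_)
    refine Pi.single_eq_of_ne (fun h => ?_) _
    have h1 := mem_multiIndices.1 a.2.2
    have h2 : (a.2 : MultiIndex n) = I := congrArg Prod.snd h
    rw [h2] at h1
    omega
  rw [h0, map_zero] at h
  exact h

theorem finite_support_partialPhi {n m : ℕ} (f : LocalFunction n m) :
    {a : Fin m × MultiIndex n | partialPhi a.1 a.2 f ≠ 0}.Finite := by
  obtain ⟨k, hf⟩ := f.2
  refine ((Finset.univ : Finset (Fin m)) ×ˢ multiIndices n k).finite_toSet.subset fun a ha => ?_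
  simp only [Finset.coe_product, Set.mem_prod, Finset.mem_coe, Finset.mem_univ, true_and,
    mem_multiIndices]
  by_contra h
  exact ha (partialPhi_eq_zero hf a.1 (not_le.1 h))

/-- The sum of a family of linear operators of which only finitely many act nontrivially on any
given local function. -/
def sumOperators {n m : ℕ} {α : Type} (T : α → LocalFunction n m →ₗ[ℝ] LocalFunction n m)
    (hT : ∀ f, {a | T a f ≠ 0}.Finite) : LocalFunction n m →ₗ[ℝ] LocalFunction n m where
  toFun f := ∑ᶠ a, T a f
  map_add' f g := by
    simp only [map_add]
    exact finsum_add_distrib (hT f) (hT g)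
  map_smul' c f := by
    simp only [map_smul, RingHom.id_apply]
    exact (smul_finsum' c (hT f)).symm

/-- The total derivative
`∂_ν = ∂/∂x^ν + ∑_{i, I} φ^i_{Iν} ∂/∂φ^i_I`. -/
def totalDeriv {n m : ℕ} (ν : Fin n) : LocalFunction n m →ₗ[ℝ] LocalFunction n m :=
  partialX ν +
    sumOperators
      (fun a : Fin m × MultiIndex n =>
        LinearMap.mulLeft ℝ (phi a.1 (a.2.append ν)) ∘ₗ partialPhi a.1 a.2)
      (fun f => (finite_support_partialPhi f).subset fun a ha h =>
        ha (by simp [h]))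

/-- The iterated total derivative `∂_I = ∂_0^{I_0} ⋯ ∂_{n-1}^{I_{n-1}}`. -/
def iteratedTotalDeriv {n m : ℕ} (I : MultiIndex n) :
    LocalFunction n m →ₗ[ℝ] LocalFunction n m :=
  (List.ofFn fun μ : Fin n => (totalDeriv μ : Module.End ℝ (LocalFunction n m)) ^ I μ).prod

/-- The Euler–Lagrange derivative `δ/δφ^i = ∑_I (-1)^{|I|} ∂_I ∂/∂φ^i_I`. -/
def eulerLagrange {n m : ℕ} (i : Fin m) : LocalFunction n m →ₗ[ℝ] LocalFunction n m :=
  sumOperators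
    (fun I : MultiIndex n =>
      ((-1 : ℝ) ^ I.length) • (iteratedTotalDeriv I ∘ₗ partialPhi i I))
    (fun f => by
      refine ((finite_support_partialPhi f).image Prod.snd).subset fun I hI => ⟨(i, I), ?_, rfl⟩
      intro h
      exact hI (by simp [h]))

end LocalFunctions

/-- Horizontal `p`-forms: alternating `p`-forms on `ℝⁿ` with local functions as coefficients.
The coefficient of `dx^{μ_1} ⋯ dx^{μ_p}` in `ω` is the value of `ω` on the basis vectors
`e_{μ_1}, …, e_{μ_p}`. -/
abbrev HorizontalForm (n m p : ℕ) : Type := (Fin n → ℝ) [⋀^Fin p]→ₗ[ℝ] LocalFunction n m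

/-- The linear map `v ↦ v^μ ∂_μ ω`, total derivatives acting on the coefficients of `ω`. -/
def totalDerivForm {n m p : ℕ} (ω : HorizontalForm n m p) :
    (Fin n → ℝ) →ₗ[ℝ] HorizontalForm n m p :=
  ∑ μ, (LinearMap.proj μ : (Fin n → ℝ) →ₗ[ℝ] ℝ).smulRight ((totalDeriv μ).compAlternatingMap ω)

/-- The horizontal differential `d_H ω = dx^μ ∂_μ ω`, that is
`(d_H ω)(v_0, …, v_p) = ∑_j (-1)^j v_j^μ (∂_μ ω)(v_0, …, v̂_j, …, v_p)`. -/
def dH (n m p : ℕ) : HorizontalForm n m p →ₗ[ℝ] HorizontalForm n m (p + 1) where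
  toFun ω := AlternatingMap.alternatizeUncurryFin (totalDerivForm ω)
  map_add' ω η := by
    rw [← AlternatingMap.alternatizeUncurryFin_add]
    congr 1
    refine LinearMap.ext fun v => ?_
    simp [totalDerivForm, Finset.sum_add_distrib]
  map_smul' c ω := by
    rw [RingHom.id_apply, ← AlternatingMap.alternatizeUncurryFin_smul]
    congr 1
    refine LinearMap.ext fun v => ?_
    simp [totalDerivForm, Finset.smul_sum, smul_comm c]

/-- The `p`-cocycles `Z^p`. -/
def cocycles (n m p : ℕ) : Submodule ℝ (HorizontalForm n m p) := LinearMap.ker (dH n m p)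

/-- The `p`-coboundaries `B^p`; there are no forms of degree `-1`. -/
def coboundaries (n m : ℕ) : (p : ℕ) → Submodule ℝ (HorizontalForm n m p)
  | 0 => ⊥
  | p + 1 => LinearMap.range (dH n m p)

/-- The cohomology `H^p(d_H) = Z^p / B^p`. -/
abbrev Cohomology (n m p : ℕ) : Type :=
  cocycles n m p ⧸ (coboundaries n m p).submoduleOf (cocycles n m p)

/-- The cohomology class of a cocycle. -/
def cohomologyClass {n m p : ℕ} : cocycles n m p →ₗ[ℝ] Cohomology n m p :=
  ((coboundaries n m p).submoduleOf (cocycles n m p)).mkQ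

/-- The `0`-form given by a constant function. -/
def constForm (n m : ℕ) (c : ℝ) : HorizontalForm n m 0 :=
  AlternatingMap.constOfIsEmpty ℝ (Fin n → ℝ) (Fin 0) (algebraMap ℝ (LocalFunction n m) c)

/-- The Lagrangian density of a top form: `ω = L dx^0 ⋯ dx^{n-1}`. -/
def density {n m : ℕ} : HorizontalForm n m n →ₗ[ℝ] LocalFunction n m where
  toFun ω := ω fun μ => Pi.single μ 1
  map_add' _ _ := rfl
  map_smul' _ _ := rfl

/-- The Euler–Lagrange derivatives `δω/δφ^i` of a top form, for all `i`. -/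
def eulerLagrangeTop (n m : ℕ) : HorizontalForm n m n →ₗ[ℝ] (Fin m → LocalFunction n m) :=
  LinearMap.pi fun i => eulerLagrange i ∘ₗ density

/-! Total derivatives commute, so `d_H² = 0` and `B^p ⊆ Z^p`. -/

/-- The direction of the total derivative `∂_ν` at a point of the jet space. -/
def totalDirection {n m : ℕ} (ν : Fin n) (z : Jet n m) : Jet n m :=
  (Pi.single ν 1, fun a => z.2 (a.1, a.2.append ν))

theorem finsum_apply_point {n m : ℕ} {α : Type} (F : α → LocalFunction n m)
    (hF : {a | F a ≠ 0}.Finite) (z : Jet n m) : (∑ᶠ a, F a).1 z = ∑ᶠ a, (F a).1 z :=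
  AddMonoidHom.map_finsum (evalAt z).toLinearMap.toAddMonoidHom hF

theorem totalDeriv_apply {n m k : ℕ} {f : LocalFunction n m} {g : FiniteJet n m k → ℝ}
    (hg : ContDiff ℝ (⊤ : ℕ∞) g) (hfg : ∀ z, f.1 z = g (truncate n m k z)) (ν : Fin n)
    (z : Jet n m) :
    (totalDeriv ν f).1 z = fderiv ℝ g (truncate n m k z) (truncate n m k (totalDirection ν z)) := by
  classical
  have hord : HasOrder k f.1 := ⟨g, hg, hfg⟩
  set L := fderiv ℝ g (truncate n m k z) with hL
  have hdir : ∀ v, (directional v f).1 z = L (truncate n m k v) := fun v =>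
    (lineDeriv_of_eq hg hfg z v).lineDeriv
  have hfin : {a : Fin m × MultiIndex n |
      (phi a.1 (a.2.append ν) * partialPhi a.1 a.2 f) ≠ 0}.Finite :=
    (finite_support_partialPhi f).subset fun a ha h => ha (by simp [h])
  have h1 : (totalDeriv ν f).1 z = (partialX ν f).1 z +
      (∑ᶠ a : Fin m × MultiIndex n, phi a.1 (a.2.append ν) * partialPhi a.1 a.2 f).1 z := rfl
  rw [h1, finsum_apply_point _ hfin]
  have hsub : (Function.support fun a : Fin m × MultiIndex n =>
      (phi a.1 (a.2.append ν) * partialPhi a.1 a.2 f).1 z) ⊆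
      ((Finset.univ : Finset (Fin m)) ×ˢ multiIndices n k : Finset _) := by
    intro a ha
    simp only [Finset.coe_product, Set.mem_prod, Finset.mem_coe, Finset.mem_univ, true_and,
      mem_multiIndices]
    by_contra h
    refine ha ?_
    simp [partialPhi_eq_zero hord a.1 (not_le.1 h)]
  rw [finsum_eq_sum_of_support_subset _ hsub]
  have hdec : truncate n m k (totalDirection ν z) = truncate n m k (Pi.single ν 1, 0) +
      ∑ a ∈ (Finset.univ : Finset (Fin m)) ×ˢ multiIndices n k,
        z.2 (a.1, a.2.append ν) • truncate n m k (0, Pi.single a 1) := by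
    refine Prod.ext ?_ (funext fun b => ?_)
    · simp [truncate, totalDirection, Prod.fst_sum]
    · simp only [truncate, totalDirection, Prod.snd_add, Prod.snd_sum, Prod.smul_snd,
        LinearMap.coe_mk, AddHom.coe_mk, Pi.add_apply, Finset.sum_apply, Pi.smul_apply,
        Pi.zero_apply, zero_add, smul_eq_mul]
      rw [Finset.sum_eq_single (b.1, (b.2 : MultiIndex n))]
      · simp
      · intro c _ hc
        rw [Pi.single_eq_of_ne (Ne.symm hc), mul_zero]
      · intro h
        exact absurd (Finset.mem_product.2 ⟨Finset.mem_univ _, b.2.2⟩) h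
  rw [hdec, map_add, map_sum]
  congr 1
  · exact hdir _
  · refine Finset.sum_congr rfl fun a _ => ?_
    rw [map_smul, ← hdir]
    rfl

/-- The linear part of `totalDirection`, from jets of order `k + 1` to jets of order `k`. -/
def shift (n m k : ℕ) (ν : Fin n) : FiniteJet n m (k + 1) →L[ℝ] FiniteJet n m k :=
  LinearMap.toContinuousLinearMap
    { toFun := fun y => (0, fun a => y.2 (a.1, ⟨a.2.1.append ν, by
        have h := mem_multiIndices.1 a.2.2
        rw [mem_multiIndices]
        simp only [MultiIndex.length, MultiIndex.append, Pi.add_apply, Finset.sum_add_distrib,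
          Finset.sum_pi_single', Finset.mem_univ, if_true] at h ⊢
        omega⟩))
      map_add' := fun _ _ => by ext <;> simp
      map_smul' := fun _ _ => by ext <;> simp }

/-- The projection `J^{k+1}(E) → J^k(E)`. -/
def lower (n m k : ℕ) : FiniteJet n m (k + 1) →L[ℝ] FiniteJet n m k :=
  LinearMap.toContinuousLinearMap
    { toFun := fun y =>
        (y.1, fun a => y.2 (a.1, ⟨a.2.1, multiIndices_mono (Nat.le_succ k) a.2.2⟩))
      map_add' := fun _ _ => rfl
      map_smul' := fun _ _ => rfl }

theorem truncate_totalDirection {n m : ℕ} (k : ℕ) (ν : Fin n) (z : Jet n m) :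
    truncate n m k (totalDirection ν z) =
      (Pi.single ν 1, 0) + shift n m k ν (truncate n m (k + 1) z) := by
  ext <;> simp [shift, truncate, totalDirection]

theorem totalDeriv_comm {n m : ℕ} (μ ν : Fin n) (f : LocalFunction n m) :
    totalDeriv μ (totalDeriv ν f) = totalDeriv ν (totalDeriv μ f) := by
  obtain ⟨k, g, hg, hfg⟩ := f.2
  have hg1 : ContDiff ℝ (⊤ : ℕ∞) (fderiv ℝ g) := hg.fderiv_right (m := (⊤ : ℕ∞)) (by simp)
  have key : ∀ (μ ν : Fin n) (z : Jet n m), (totalDeriv μ (totalDeriv ν f)).1 z =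
      fderiv ℝ (fderiv ℝ g) (truncate n m k z) (truncate n m k (totalDirection μ z))
        (truncate n m k (totalDirection ν z)) +
      fderiv ℝ g (truncate n m k z)
        (shift n m k ν (truncate n m (k + 1) (totalDirection μ z))) := by
    intro μ ν z
    let G : FiniteJet n m (k + 1) → ℝ := fun y =>
      fderiv ℝ g (lower n m k y) ((Pi.single ν 1, 0) + shift n m k ν y)
    have hG : ContDiff ℝ (⊤ : ℕ∞) G :=
      (hg1.comp (lower n m k).contDiff).clm_apply
        (contDiff_const.add (shift n m k ν).contDiff)
    have hfG : ∀ z, (totalDeriv ν f).1 z = G (truncate n m (k + 1) z) := by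
      intro z
      rw [totalDeriv_apply hg hfg, truncate_totalDirection]
      rfl
    rw [totalDeriv_apply hG hfG]
    have hd : HasFDerivAt G _ (truncate n m (k + 1) z) :=
      HasFDerivAt.clm_apply
        (((hg1.differentiable (by simp)) _).hasFDerivAt.comp _ (lower n m k).hasFDerivAt)
        ((shift n m k ν).hasFDerivAt.const_add (Pi.single ν 1, 0))
    rw [hd.fderiv, truncate_totalDirection k ν]
    simp only [add_apply, ContinuousLinearMap.comp_apply,
      ContinuousLinearMap.flip_apply]
    rw [add_comm]
    rfl
  ext z
  rw [key, key]
  have hsymm : IsSymmSndFDerivAt ℝ g (truncate n m k z) :=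
    hg.contDiffAt.isSymmSndFDerivAt (by
      rw [minSmoothness_of_isRCLikeNormedField]
      exact WithTop.coe_le_coe.2 le_top)
  rw [hsymm.eq]
  congr 2
  refine Prod.ext rfl (funext fun a => ?_)
  have : (a.2.1.append ν).append μ = (a.2.1.append μ).append ν := add_right_comm _ _ _
  exact congrArg (fun I => z.2 (a.1, I)) this

theorem dH_dH {n m p : ℕ} (ω : HorizontalForm n m p) : dH n m (p + 1) (dH n m p ω) = 0 := by
  let f : (Fin n → ℝ) →ₗ[ℝ] (Fin n → ℝ) →ₗ[ℝ] HorizontalForm n m p :=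
    ∑ μ, (LinearMap.proj μ : (Fin n → ℝ) →ₗ[ℝ] ℝ).smulRight
      (totalDerivForm ((totalDeriv μ).compAlternatingMap ω))
  have hf : ∀ x y, f x y = f y x := by
    intro x y
    simp only [f, totalDerivForm, LinearMap.sum_apply, LinearMap.smulRight_apply,
      LinearMap.smul_apply, LinearMap.proj_apply, Finset.smul_sum]
    rw [Finset.sum_comm]
    refine Finset.sum_congr rfl fun μ _ => Finset.sum_congr rfl fun ν _ => ?_
    rw [smul_comm]
    congr 2
    ext v : 1
    exact totalDeriv_comm _ _ _
  have h0 := AlternatingMap.alternatizeUncurryFin_alternatizeUncurryFinLM_comp_of_symmetric hf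
  rw [← h0]
  change AlternatingMap.alternatizeUncurryFin _ = _
  congr 1
  refine LinearMap.ext fun x => ?_
  simp only [f, totalDerivForm, LinearMap.sum_apply, LinearMap.smulRight_apply,
    LinearMap.proj_apply, LinearMap.comp_apply, map_sum, map_smul]
  refine Finset.sum_congr rfl fun μ _ => ?_
  congr 1
  ext v : 1
  rw [← map_sum, AlternatingMap.alternatizeUncurryFinLM_apply]
  change totalDeriv μ (AlternatingMap.alternatizeUncurryFin (totalDerivForm ω) v) = _
  rw [AlternatingMap.alternatizeUncurryFin_apply, AlternatingMap.alternatizeUncurryFin_apply,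
    map_sum]
  refine Finset.sum_congr rfl fun i _ => ?_
  rw [map_zsmul]
  congr 1
  have hev : ∀ (F : Fin n → HorizontalForm n m p) (w : Fin p → Fin n → ℝ),
      (∑ ν, F ν) w = ∑ ν, F ν w := fun F w =>
    map_sum ({ toFun := fun η => η w, map_zero' := rfl, map_add' := fun _ _ => rfl } :
      HorizontalForm n m p →+ LocalFunction n m) F Finset.univ
  simp only [totalDerivForm, LinearMap.sum_apply, LinearMap.smulRight_apply,
    LinearMap.proj_apply, hev, AlternatingMap.smul_apply, map_sum, map_smul,
    LinearMap.compAlternatingMap_apply]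
  refine Finset.sum_congr rfl fun ν _ => ?_
  congr 1
  exact totalDeriv_comm _ _ _

theorem coboundaries_le_cocycles (n m p : ℕ) : coboundaries n m p ≤ cocycles n m p := by
  cases p with
  | zero => exact bot_le
  | succ p =>
    rintro _ ⟨η, rfl⟩
    exact dH_dH η

end HorizontalComplex

end

/-!
The horizontal complex is the Koszul complex of the commuting total derivatives `∂_0, …, ∂_{n-1}`
on the space `A` of local functions. Two properties of these operators determine its cohomology.

* Regularity (`totalDeriv_regular`): for `r ≥ 1`, if `∂_r f` is a sum of total derivatives in the
  directions `s < r`, then so is `f`.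
* Solvability (`totalDeriv_coregular`): for `r ≥ 1`, if `∂_s b = 0` for all `s < r`, then
  `b = ∂_r c` for some `c` with `∂_s c = 0` for all `s < r`.

They imply that the complex is exact in the degrees `0 < p < n`, by induction on the number of
directions in which one differentiates (`koszul_exact`), while `H^n = A / ∑_s ∂_s A` for any
commuting operators (`exact_of_topCoeff_mem`, `topCoeff_koszulD_mem`).

Both properties, as well as the description of `∑_s ∂_s A` by the Euler–Lagrange derivatives, come
from the higher Euler operators `E^J_i`. To a local function `f` belongs its linearization, the
differential operator `∑_I (∂f/∂φ^i_I) ∂_I`, written as the polynomial `∑_I (∂f/∂φ^i_I) X^I` with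
coefficients in `A`. The linearization of `∂_ν f` is `(X_ν + ∂_ν)` applied to that of `f`. The
substitution `X ↦ X - ∂`, with inverse `X ↦ X + ∂`, turns `X_ν + ∂_ν` into `X_ν`, and the `E^J_i(f)`
are the coefficients of the polynomial which it makes of the linearization. Hence
`E^J_i(∂_ν f) = E^{J - ν}_i(f)`, which is zero if `ν` does not occur in `J`
(`higherEuler_totalDeriv`), and `E^0_i` is the Euler–Lagrange derivative
(`higherEuler_apply_zero`). Integration of the linearization along the segments from `(x, 0)` to
`(x, φ)`, followed by the inverse substitution, gives the homotopy formula
(`eq_zeroSection_add_sum_opPow`)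
`f(x, φ) = f(x, 0) + ∑_{i, J} ∂_J (φ^i ∫₀¹ E^J_i(f)(x, tφ) dt)`.

The function `f(x, 0)` is a derivative `∂_0 c`. So, for `r ≥ 1`, `f` is a sum of total derivatives
in the directions `s < r` if and only if `E^J_i(f) = 0` for all `J` in which no `s < r` occurs
(`mem_rangeBelow_iff`). For `r = n` these are the Euler–Lagrange equations `E^0_i(f) = 0`, and
regularity is the relation `E^J_i(f) = E^{J + r}_i(∂_r f)`. If `∂_s f = 0`, the same relation shows
that all `E^J_i(f)` vanish, so that `f` is a function of `x`. This reduces solvability to an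
integration in the direction of `x^r` and gives `H^0 = ℝ`.
-/

noncomputable section

namespace HorizontalComplex

/-! ### Integrals depending smoothly on a parameter -/

section ParametricIntegral

open scoped ContDiff
open MeasureTheory Set

variable {E F : Type} [NormedAddCommGroup E] [NormedSpace ℝ E] [NormedAddCommGroup F]
  [NormedSpace ℝ F]

theorem contDiff_fderiv_parameter {H : E → ℝ → F} (hH : ContDiff ℝ ∞ (Function.uncurry H)) :
    ContDiff ℝ ∞ (Function.uncurry fun x t => fderiv ℝ (fun y => H y t) x) := by
  have h : ContDiff ℝ ∞ (Function.uncurry fun (p : E × ℝ) (y : E) => H y p.2) :=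
    hH.comp (contDiff_snd.prodMk (contDiff_snd.comp contDiff_fst))
  exact h.fderiv contDiff_fst (by simp)

theorem hasFDerivAt_integral_parameter [FiniteDimensional ℝ E] {H : E → ℝ → F}
    (hH : ContDiff ℝ ∞ (Function.uncurry H)) (x : E) :
    HasFDerivAt (fun y => ∫ t in (0 : ℝ)..1, H y t)
      (∫ t in (0 : ℝ)..1, fderiv ℝ (fun y => H y t) x) x := by
  have hD := (contDiff_fderiv_parameter hH).continuous
  have hc : ∀ y, Continuous (H y) := fun y =>
    hH.continuous.comp (Continuous.prodMk continuous_const continuous_id)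
  have hcD : Continuous fun t => fderiv ℝ (fun y => H y t) x :=
    hD.comp (Continuous.prodMk continuous_const continuous_id)
  have : ProperSpace E := FiniteDimensional.proper ℝ E
  obtain ⟨C, hC⟩ := ((isCompact_closedBall x 1).prod (isCompact_Icc (a := (0 : ℝ)) (b := 1))
    ).exists_bound_of_continuousOn hD.continuousOn
  refine intervalIntegral.hasFDerivAt_integral_of_dominated_of_fderiv_le
    (F' := fun y t => fderiv ℝ (fun y => H y t) y) (bound := fun _ => C)
    (Metric.closedBall_mem_nhds x one_pos) (.of_forall fun y => (hc y).aestronglyMeasurable)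
    ((hc x).intervalIntegrable _ _) hcD.aestronglyMeasurable ?_ intervalIntegrable_const ?_
  · refine .of_forall fun t ht y hy => hC (y, t) ⟨hy, ?_⟩
    rw [uIoc_of_le zero_le_one] at ht
    exact ⟨ht.1.le, ht.2⟩
  · refine .of_forall fun t _ y _ => DifferentiableAt.hasFDerivAt ?_
    have h : ContDiff ℝ ∞ fun y => H y t := hH.comp (contDiff_id.prodMk contDiff_const)
    exact h.differentiable (by simp) y

theorem contDiff_integral_parameter [FiniteDimensional ℝ E] {H : E → ℝ → F}
    (hH : ContDiff ℝ ∞ (Function.uncurry H)) :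
    ContDiff ℝ ∞ fun y => ∫ t in (0 : ℝ)..1, H y t := by
  rw [contDiff_infty]
  intro k
  induction k generalizing F with
  | zero =>
    refine contDiff_zero.2 (continuous_iff_continuousAt.2 fun x => ?_)
    exact (hasFDerivAt_integral_parameter hH x).continuousAt
  | succ k ih =>
    rw [Nat.cast_add, Nat.cast_one, contDiff_succ_iff_fderiv]
    refine ⟨fun x => (hasFDerivAt_integral_parameter hH x).differentiableAt, by simp, ?_⟩
    rw [funext fun x => (hasFDerivAt_integral_parameter hH x).fderiv]
    exact ih (contDiff_fderiv_parameter hH)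

end ParametricIntegral

/-! ### Koszul complexes of commuting operators -/

section Koszul

variable {n : ℕ} {A : Type*} [AddCommGroup A] [Module ℝ A]

/-- The `A`-valued alternating `p`-forms on `ℝⁿ`. -/
abbrev Form (n : ℕ) (A : Type*) [AddCommGroup A] [Module ℝ A] (p : ℕ) : Type _ :=
  (Fin n → ℝ) [⋀^Fin p]→ₗ[ℝ] A

/-- The operator `v ↦ v^μ D_μ ω` attached to a family of operators `D_μ` on the coefficients. -/
def coefficientDeriv (D : Fin n → Module.End ℝ A) {p : ℕ} (ω : Form n A p) :
    (Fin n → ℝ) →ₗ[ℝ] Form n A p :=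
  ∑ μ, (LinearMap.proj μ : (Fin n → ℝ) →ₗ[ℝ] ℝ).smulRight ((D μ).compAlternatingMap ω)

theorem coefficientDeriv_apply (D : Fin n → Module.End ℝ A) {p : ℕ} (ω : Form n A p)
    (v : Fin n → ℝ) (w : Fin p → Fin n → ℝ) :
    coefficientDeriv D ω v w = ∑ μ, v μ • D μ (ω w) := by
  have hev : ∀ F : Fin n → Form n A p, (∑ μ, F μ) w = ∑ μ, F μ w := fun F =>
    map_sum ({ toFun := fun η => η w, map_zero' := rfl, map_add' := fun _ _ => rfl } :
      Form n A p →+ A) F Finset.univ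
  simp [coefficientDeriv, hev]

/-- The Koszul differential `ω ↦ dx^μ ∧ D_μ ω`. The horizontal differential is the case of the
total derivatives, and the exterior product with `dx^r` is the case of the family that is the
identity for `μ = r` and zero otherwise. -/
def koszulD (D : Fin n → Module.End ℝ A) {p : ℕ} (ω : Form n A p) : Form n A (p + 1) :=
  AlternatingMap.alternatizeUncurryFin (coefficientDeriv D ω)

theorem koszulD_apply (D : Fin n → Module.End ℝ A) {p : ℕ} (ω : Form n A p)
    (v : Fin (p + 1) → Fin n → ℝ) :
    koszulD D ω v =
      ∑ j : Fin (p + 1), (-1 : ℤ) ^ (j : ℕ) • ∑ μ, v j μ • D μ (ω (j.removeNth v)) := by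
  simp [koszulD, AlternatingMap.alternatizeUncurryFin_apply, coefficientDeriv_apply]

theorem koszulD_add (D : Fin n → Module.End ℝ A) {p : ℕ} (ω η : Form n A p) :
    koszulD D (ω + η) = koszulD D ω + koszulD D η := by
  ext v
  simp [koszulD_apply, Finset.sum_add_distrib]

theorem koszulD_zero (D : Fin n → Module.End ℝ A) {p : ℕ} :
    koszulD D (0 : Form n A p) = 0 := by
  ext v
  simp [koszulD_apply]

theorem koszulD_neg (D : Fin n → Module.End ℝ A) {p : ℕ} (ω : Form n A p) :
    koszulD D (-ω) = -koszulD D ω := by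
  rw [eq_neg_iff_add_eq_zero, ← koszulD_add, neg_add_cancel, koszulD_zero]

theorem koszulD_sub (D : Fin n → Module.End ℝ A) {p : ℕ} (ω η : Form n A p) :
    koszulD D (ω - η) = koszulD D ω - koszulD D η := by
  rw [sub_eq_add_neg, koszulD_add, koszulD_neg, sub_eq_add_neg]

theorem koszulD_add_operators (D D' : Fin n → Module.End ℝ A) {p : ℕ} (ω : Form n A p) :
    koszulD (D + D') ω = koszulD D ω + koszulD D' ω := by
  ext v
  simp [koszulD_apply, Finset.sum_add_distrib]

/-- The contraction `ι_μ` of a form with the basis vector `e_μ`. -/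
def contract {p : ℕ} (μ : Fin n) (ω : Form n A (p + 1)) : Form n A p :=
  ω.curryLeft (Pi.single μ 1)

theorem contract_apply {p : ℕ} (μ : Fin n) (ω : Form n A (p + 1)) (v : Fin p → Fin n → ℝ) :
    contract μ ω v = ω (Matrix.vecCons (Pi.single μ 1) v) := rfl

theorem contract_add {p : ℕ} (μ : Fin n) (ω η : Form n A (p + 1)) :
    contract μ (ω + η) = contract μ ω + contract μ η := rfl

theorem contract_sub {p : ℕ} (μ : Fin n) (ω η : Form n A (p + 1)) :
    contract μ (ω - η) = contract μ ω - contract μ η := rfl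

theorem contract_neg {p : ℕ} (μ : Fin n) (ω : Form n A (p + 1)) :
    contract μ (-ω) = -contract μ ω := rfl

theorem contract_zero {p : ℕ} (μ : Fin n) : contract μ (0 : Form n A (p + 1)) = 0 := rfl

theorem contract_comp {p : ℕ} (μ : Fin n) (T : Module.End ℝ A) (ω : Form n A (p + 1)) :
    contract μ (T.compAlternatingMap ω) = T.compAlternatingMap (contract μ ω) := rfl

theorem contract_self {p : ℕ} (μ : Fin n) (ω : Form n A (p + 2)) :
    contract μ (contract μ ω) = 0 :=
  ω.curryLeft_same _

theorem contract_anticomm {p : ℕ} (μ ν : Fin n) (ω : Form n A (p + 2)) :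
    contract μ (contract ν ω) = -contract ν (contract μ ω) := by
  have h := ω.curryLeft_same (Pi.single μ 1 + Pi.single ν 1)
  simp only [map_add, AlternatingMap.curryLeft_add, LinearMap.add_apply,
    AlternatingMap.curryLeft_same, zero_add, add_zero] at h
  exact eq_neg_of_add_eq_zero_left h

/-- A form of positive degree is determined by its contractions with the basis vectors. -/
theorem form_ext {p : ℕ} {ω η : Form n A (p + 1)} (h : ∀ μ, contract μ ω = contract μ η) :
    ω = η := by
  have hc : ω.curryLeft = η.curryLeft :=
    (Pi.basisFun ℝ (Fin n)).ext fun μ => by simpa [contract] using h μ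
  ext v
  have := congrArg (fun f => f (v 0)) hc
  have hv : Matrix.vecCons (v 0) (Matrix.vecTail v) = v := Matrix.cons_head_tail v
  rw [← hv]
  exact congrArg (fun f => f (Matrix.vecTail v)) this

theorem form_zero_ext {ω η : Form n A 0} (h : ω ![] = η ![]) : ω = η := by
  ext v
  rw [Subsingleton.elim v ![], h]

/-- Cartan's formula `ι_μ d + d ι_μ = D_μ`. -/
theorem contract_koszulD {p : ℕ} (D : Fin n → Module.End ℝ A) (μ : Fin n)
    (ω : Form n A (p + 1)) :
    contract μ (koszulD D ω) = (D μ).compAlternatingMap ω - koszulD D (contract μ ω) := by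
  ext v
  rw [contract_apply, koszulD_apply, Fin.sum_univ_succ, sub_eq_add_neg]
  simp only [AlternatingMap.add_apply, AlternatingMap.neg_apply]
  congr 1
  · simp only [Fin.val_zero, pow_zero, one_smul, Matrix.cons_val_zero]
    rw [Finset.sum_eq_single μ]
    · simp only [Pi.single_eq_same, one_smul]
      rfl
    · intro ν _ hν
      rw [Pi.single_eq_of_ne hν, zero_smul]
    · simp
  · rw [koszulD_apply, ← Finset.sum_neg_distrib]
    refine Finset.sum_congr rfl fun j _ => ?_
    rw [Fin.val_succ, pow_succ, mul_neg_one, neg_smul]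
    congr 2
    refine Finset.sum_congr rfl fun ν _ => ?_
    congr 2
    rw [contract_apply]
    congr 1
    ext i : 1
    refine Fin.cases ?_ (fun i => ?_) i
    · rfl
    · simp [Fin.removeNth]

theorem contract_koszulD_zero (D : Fin n → Module.End ℝ A) (μ : Fin n) (ω : Form n A 0) :
    contract μ (koszulD D ω) = (D μ).compAlternatingMap ω := by
  refine form_zero_ext ?_
  rw [contract_apply, koszulD_apply, Fin.sum_univ_one]
  simp only [Fin.val_zero, pow_zero, one_smul, Matrix.cons_val_zero]
  rw [Finset.sum_eq_single μ]
  · simp only [Pi.single_eq_same, one_smul, LinearMap.compAlternatingMap_apply]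
    congr 2
  · intro ν _ hν
    rw [Pi.single_eq_of_ne hν, zero_smul]
  · simp

theorem comp_koszulD {p : ℕ} {D : Fin n → Module.End ℝ A} {T : Module.End ℝ A}
    (h : ∀ μ a, T (D μ a) = D μ (T a)) (ω : Form n A p) :
    T.compAlternatingMap (koszulD D ω) = koszulD D (T.compAlternatingMap ω) := by
  ext v
  simp [koszulD_apply, h]

/-- The Koszul differentials of mutually commuting families anticommute. -/
theorem koszulD_anticomm {p : ℕ} {D D' : Fin n → Module.End ℝ A}
    (h : ∀ μ ν a, D μ (D' ν a) = D' ν (D μ a)) (ω : Form n A p) :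
    koszulD D (koszulD D' ω) = -koszulD D' (koszulD D ω) := by
  induction p with
  | zero =>
    refine form_ext fun μ => ?_
    rw [contract_neg, contract_koszulD, contract_koszulD, contract_koszulD_zero,
      contract_koszulD_zero, comp_koszulD fun ν a => h μ ν a,
      comp_koszulD fun ν a => (h ν μ a).symm]
    abel
  | succ p ih =>
    refine form_ext fun μ => ?_
    rw [contract_neg, contract_koszulD, contract_koszulD, contract_koszulD,
      contract_koszulD, comp_koszulD fun ν a => h μ ν a,
      comp_koszulD fun ν a => (h ν μ a).symm, koszulD_sub, koszulD_sub, ih]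
    abel

/-- The family of operators that agrees with `D` in the directions `μ < r` and vanishes in the
others. -/
def initial (D : Fin n → Module.End ℝ A) (r : ℕ) : Fin n → Module.End ℝ A :=
  fun μ => if μ.1 < r then D μ else 0

/-- The form `dx^r ∧ ω`. -/
def wedge {p : ℕ} (r : Fin n) (ω : Form n A p) : Form n A (p + 1) :=
  koszulD (Pi.single r 1) ω

theorem wedge_koszulD {p : ℕ} (r : Fin n) (D : Fin n → Module.End ℝ A) (ω : Form n A p) :
    koszulD D (wedge r ω) = -wedge r (koszulD D ω) := by
  refine koszulD_anticomm (fun μ ν a => ?_) ω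
  rcases eq_or_ne ν r with rfl | hν
  · simp
  · simp [Pi.single_eq_of_ne hν]

theorem wedge_wedge {p : ℕ} (r : Fin n) (ω : Form n A p) : wedge r (wedge r ω) = 0 := by
  have h := wedge_koszulD r (Pi.single r 1) ω
  have h2 : (2 : ℝ) • wedge r (wedge r ω) = 0 := by
    rw [two_smul]
    exact eq_neg_iff_add_eq_zero.1 h
  exact (smul_eq_zero.1 h2).resolve_left two_ne_zero

theorem wedge_sub {p : ℕ} (r : Fin n) (ω η : Form n A p) :
    wedge r (ω - η) = wedge r ω - wedge r η := koszulD_sub _ _ _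

theorem wedge_add {p : ℕ} (r : Fin n) (ω η : Form n A p) :
    wedge r (ω + η) = wedge r ω + wedge r η := koszulD_add _ _ _

theorem wedge_zero {p : ℕ} (r : Fin n) : wedge r (0 : Form n A p) = 0 := koszulD_zero _

theorem contract_wedge_self {p : ℕ} (r : Fin n) (ω : Form n A (p + 1)) :
    contract r (wedge r ω) = ω - wedge r (contract r ω) := by
  rw [wedge, contract_koszulD, Pi.single_eq_same]
  rfl

theorem contract_wedge_of_ne {p : ℕ} {r μ : Fin n} (h : μ ≠ r) (ω : Form n A (p + 1)) :
    contract μ (wedge r ω) = -wedge r (contract μ ω) := by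
  rw [wedge, contract_koszulD, Pi.single_eq_of_ne h, ← zero_sub]
  rfl

theorem contract_wedge_self_zero (r : Fin n) (ω : Form n A 0) : contract r (wedge r ω) = ω := by
  rw [wedge, contract_koszulD_zero, Pi.single_eq_same]
  rfl

theorem contract_wedge_of_ne_zero {r μ : Fin n} (h : μ ≠ r) (ω : Form n A 0) :
    contract μ (wedge r ω) = 0 := by
  rw [wedge, contract_koszulD_zero, Pi.single_eq_of_ne h]
  rfl

theorem koszulD_initial_succ {p : ℕ} (D : Fin n → Module.End ℝ A) (r : Fin n) (ω : Form n A p) :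
    koszulD (initial D (r + 1)) ω =
      koszulD (initial D r) ω + wedge r ((D r).compAlternatingMap ω) := by
  have h : initial D (r + 1) = initial D r + Pi.single r (D r) := by
    funext μ
    rcases eq_or_ne μ r with rfl | hμ
    · simp [initial]
    · have : μ.1 < r.1 + 1 ↔ μ.1 < r.1 := by
        have := Fin.val_ne_of_ne hμ
        omega
      simp [initial, Pi.single_eq_of_ne hμ, this]
  rw [h, koszulD_add_operators]
  congr 1
  ext v
  simp only [wedge, koszulD_apply, LinearMap.compAlternatingMap_apply]
  refine Finset.sum_congr rfl fun j _ => ?_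
  congr 1
  refine Finset.sum_congr rfl fun μ _ => ?_
  rcases eq_or_ne μ r with rfl | hμ
  · simp
  · simp [Pi.single_eq_of_ne hμ]

/-- `ω` only involves the differentials `dx^μ` with `μ < r`: its contractions with the other basis
vectors vanish. Forms of degree zero involve no differentials. -/
def Involves (r : ℕ) : {p : ℕ} → Form n A p → Prop
  | 0, _ => True
  | _ + 1, ω => ∀ μ : Fin n, r ≤ μ → contract μ ω = 0

theorem Involves.mono {r s p : ℕ} (h : r ≤ s) {ω : Form n A p} (hω : Involves r ω) :
    Involves s ω := by
  cases p with
  | zero => trivial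
  | succ p => exact fun μ hμ => hω μ (h.trans hμ)

theorem Involves.sub {r p : ℕ} {ω η : Form n A p} (hω : Involves r ω) (hη : Involves r η) :
    Involves r (ω - η) := by
  cases p with
  | zero => trivial
  | succ p => exact fun μ hμ => by rw [contract_sub, hω μ hμ, hη μ hμ, sub_zero]

theorem Involves.comp {r p : ℕ} {ω : Form n A p} (hω : Involves r ω) (T : Module.End ℝ A) :
    Involves r (T.compAlternatingMap ω) := by
  cases p with
  | zero => trivial
  | succ p =>
    intro μ hμ
    rw [contract_comp, hω μ hμ]
    ext v
    simp

theorem Involves.contract {p : ℕ} {r : Fin n} {ω : Form n A (p + 1)}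
    (hω : Involves (r + 1) ω) : Involves r (contract r ω) := by
  cases p with
  | zero => trivial
  | succ p =>
    intro μ hμ
    rcases eq_or_ne μ r with rfl | h
    · exact contract_self _ _
    · have : r.1 + 1 ≤ μ := by
        have := Fin.val_ne_of_ne h
        omega
      rw [contract_anticomm, hω μ this, contract_zero, neg_zero]

theorem Involves.wedge {p : ℕ} {r : Fin n} {ω : Form n A p} (hω : Involves r ω) :
    Involves (r + 1) (wedge r ω) := by
  intro μ hμ
  have h : μ ≠ r := by
    rintro rfl
    omega
  cases p with
  | zero => exact contract_wedge_of_ne_zero h ω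
  | succ p => rw [contract_wedge_of_ne h, hω μ (by omega), wedge_zero, neg_zero]

theorem Involves.contract_wedge {p : ℕ} {r : Fin n} {ω : Form n A p} (hω : Involves r ω) :
    HorizontalComplex.contract r (HorizontalComplex.wedge r ω) = ω := by
  cases p with
  | zero => exact contract_wedge_self_zero r ω
  | succ p => rw [contract_wedge_self, hω r le_rfl, wedge_zero, sub_zero]

theorem Involves.koszulD {r p : ℕ} (D : Fin n → Module.End ℝ A) {ω : Form n A p}
    (hω : Involves r ω) : Involves r (koszulD (initial D r) ω) := by
  intro μ hμ
  have h : initial D r μ = 0 := if_neg (by omega)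
  cases p with
  | zero =>
    rw [contract_koszulD_zero, h]
    rfl
  | succ p =>
    rw [contract_koszulD, h, hω μ hμ, koszulD_zero, sub_zero]
    rfl

/-- The form `ω - dx^r ∧ ι_r ω` is the part of `ω` that does not contain `dx^r`. -/
theorem Involves.sub_wedge_contract {p : ℕ} {r : Fin n} {ω : Form n A (p + 1)}
    (hω : Involves (r + 1) ω) :
    Involves r (ω - HorizontalComplex.wedge r (HorizontalComplex.contract r ω)) := by
  intro μ hμ
  rcases eq_or_ne μ r with rfl | h
  · rw [contract_sub, hω.contract.contract_wedge, sub_self]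
  · have h' : r.1 + 1 ≤ μ := by
      have := Fin.val_ne_of_ne h
      omega
    rw [contract_sub, hω μ h', (hω.contract.wedge) μ h', sub_zero]

theorem Involves.eq_zero {r p : ℕ} (hr : r ≤ n) (hp : r < p) {ω : Form n A p}
    (hω : Involves r ω) : ω = 0 := by
  induction r generalizing p with
  | zero =>
    obtain ⟨p, rfl⟩ : ∃ q, p = q + 1 := ⟨p - 1, by omega⟩
    exact form_ext fun μ => hω μ (Nat.zero_le _)
  | succ r ih =>
    obtain ⟨p, rfl⟩ : ∃ q, p = q + 1 := ⟨p - 1, by omega⟩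
    have hω' : Involves ((⟨r, hr⟩ : Fin n) + 1 : ℕ) ω := hω
    have h1 : HorizontalComplex.contract ⟨r, hr⟩ ω = 0 :=
      ih (Nat.le_of_succ_le hr) (by omega) hω'.contract
    have h2 := hω'.sub_wedge_contract
    rw [h1, wedge_zero, sub_zero] at h2
    exact ih (Nat.le_of_succ_le hr) (by omega) h2

/-- `ω` is exact for the operators `D_μ`, `μ < r`, with a primitive that only involves `dx^μ`,
`μ < r`. There are no forms of degree `-1`. -/
def Exact (D : Fin n → Module.End ℝ A) (r : ℕ) : {p : ℕ} → Form n A p → Prop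
  | 0, ω => ω = 0
  | p + 1, ω => ∃ η : Form n A p, Involves r η ∧ koszulD (initial D r) η = ω

/-- The sum of the ranges of the operators `D_μ`, `μ < r`. -/
def rangeBelow (D : Fin n → Module.End ℝ A) (r : ℕ) : Submodule ℝ A :=
  ⨆ μ : Fin n, LinearMap.range (initial D r μ)

theorem apply_mem_rangeBelow (D : Fin n → Module.End ℝ A) {r : ℕ} {μ : Fin n} (h : μ.1 < r)
    (a : A) : D μ a ∈ rangeBelow D r := by
  have h1 : initial D r μ a ∈ rangeBelow D r :=
    Submodule.mem_iSup_of_mem μ (LinearMap.mem_range_self _ a)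
  rwa [initial, if_pos h] at h1

theorem rangeBelow_zero (D : Fin n → Module.End ℝ A) : rangeBelow D 0 = ⊥ := by
  simp [rangeBelow, initial]

theorem mem_rangeBelow_succ {D : Fin n → Module.End ℝ A} {r : Fin n} {a : A}
    (h : a ∈ rangeBelow D (r + 1)) : ∃ b, a - D r b ∈ rangeBelow D r := by
  have hle : rangeBelow D (r + 1) ≤ rangeBelow D r ⊔ LinearMap.range (D r) := by
    refine iSup_le fun μ => ?_
    rintro _ ⟨b, rfl⟩
    by_cases h1 : μ.1 < r
    · have h2 : initial D (r + 1) μ = D μ := if_pos (by omega)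
      rw [h2]
      exact Submodule.mem_sup_left (apply_mem_rangeBelow D h1 b)
    · by_cases h2 : μ = r
      · subst h2
        have h2 : initial D (μ + 1) μ = D μ := if_pos (by omega)
        rw [h2]
        exact Submodule.mem_sup_right (LinearMap.mem_range_self _ b)
      · have h3 := Fin.val_ne_of_ne h2
        have h2 : initial D (r + 1) μ = 0 := if_neg (by omega)
        rw [h2]
        exact Submodule.zero_mem _
  obtain ⟨y, hy, _, ⟨b, rfl⟩, rfl⟩ := Submodule.mem_sup.1 (hle h)
  exact ⟨b, by simpa using hy⟩

/-- The coefficient of a `p`-form on the basis vectors `e_{p-1}, …, e_0`. The descending order makes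
it compatible with contraction in the first argument. -/
def topCoeff {p : ℕ} (hp : p ≤ n) (ω : Form n A p) : A :=
  ω fun j => Pi.single ⟨p - 1 - j, by omega⟩ 1

theorem topCoeff_succ {p : ℕ} (hp : p < n) (ω : Form n A (p + 1)) :
    topCoeff hp ω = topCoeff hp.le (contract ⟨p, hp⟩ ω) := by
  rw [topCoeff, topCoeff, contract_apply]
  congr 1
  funext j
  refine Fin.cases ?_ (fun j => ?_) j
  · simp
  · simp only [Matrix.cons_val_succ, Fin.val_succ]
    congr 2
    omega

theorem topCoeff_koszulD_mem (D : Fin n → Module.End ℝ A) {p : ℕ} (hp : p + 1 ≤ n) (r : ℕ)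
    (ω : Form n A p) : topCoeff hp (koszulD (initial D r) ω) ∈ rangeBelow D r := by
  rw [topCoeff, koszulD_apply]
  refine Submodule.sum_mem _ fun j _ => zsmul_mem (Submodule.sum_mem _ fun μ _ => ?_) _
  exact Submodule.smul_mem _ _ (Submodule.mem_iSup_of_mem μ (LinearMap.mem_range_self _ _))

theorem exists_topCoeff_eq {r : ℕ} (hr : r ≤ n) (a : A) :
    ∃ ω : Form n A r, Involves r ω ∧ topCoeff hr ω = a := by
  induction r with
  | zero => exact ⟨AlternatingMap.constOfIsEmpty ℝ _ _ a, trivial, rfl⟩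
  | succ r ih =>
    obtain ⟨ω, hω, h⟩ := ih (Nat.le_of_succ_le hr)
    have hω' : Involves (⟨r, hr⟩ : Fin n) ω := hω
    exact ⟨wedge ⟨r, hr⟩ ω, hω'.wedge, by rw [topCoeff_succ hr, hω'.contract_wedge, h]⟩

/-- A form in `dx^0, …, dx^{r-1}` of degree `r` is exact as soon as its coefficient is a sum of
derivatives. In the step from `r` to `r + 1` the form is `dx^r ∧ β`, and `β - D_r g` is `d δ` for
some form `g`, so that `g - dx^r ∧ δ` is a primitive. -/
theorem exact_of_topCoeff_mem {D : Fin n → Module.End ℝ A} {r : ℕ} (hr : r ≤ n)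
    {ω : Form n A r} (hω : Involves r ω) (h : topCoeff hr ω ∈ rangeBelow D r) : Exact D r ω := by
  induction r with
  | zero =>
    rw [rangeBelow_zero, Submodule.mem_bot] at h
    have h0 : topCoeff hr ω = ω ![] := congrArg ω (Subsingleton.elim _ _)
    exact form_zero_ext (h0.symm.trans h)
  | succ r ih =>
    set ρ : Fin n := ⟨r, hr⟩ with hρ
    have hω' : Involves (ρ + 1 : ℕ) ω := hω
    set β := contract ρ ω with hβ
    have hβr : Involves r β := hω'.contract
    have hωβ : ω = wedge ρ β :=
      sub_eq_zero.1 (hω'.sub_wedge_contract.eq_zero (Nat.le_of_succ_le hr) (Nat.lt_succ_self r))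
    rw [topCoeff_succ hr] at h
    obtain ⟨b, hb⟩ := mem_rangeBelow_succ (r := ρ) h
    obtain ⟨g, hg, rfl⟩ := exists_topCoeff_eq (Nat.le_of_succ_le hr) b
    have hdg : koszulD (initial D ρ) g = 0 :=
      (hg.koszulD D).eq_zero (Nat.le_of_succ_le hr) (Nat.lt_succ_self r)
    have hex := ih (Nat.le_of_succ_le hr) (hβr.sub (hg.comp (D ρ))) hb
    cases r with
    | zero =>
      refine ⟨g, trivial, ?_⟩
      have h0 : β = (D ρ).compAlternatingMap g := sub_eq_zero.1 hex
      exact (koszulD_initial_succ D ρ g).trans (by rw [hdg, ← h0, ← hωβ]; exact zero_add ω)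
    | succ r =>
      obtain ⟨δ, hδ, hδβ⟩ := hex
      have hδ' : Involves ρ δ := hδ
      refine ⟨g - wedge ρ δ, (hg.mono (Nat.le_succ _)).sub hδ'.wedge, ?_⟩
      have hδβ' : koszulD (initial D ρ) δ = β - (D ρ).compAlternatingMap g := hδβ
      have hcomm : (D ρ).compAlternatingMap (wedge ρ δ) =
          wedge ρ ((D ρ).compAlternatingMap δ) := comp_koszulD (fun μ a => by
        rcases eq_or_ne μ ρ with rfl | hμ
        · simp
        · simp [Pi.single_eq_of_ne hμ]) δ
      refine (koszulD_initial_succ D ρ _).trans ?_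
      have hsub : (D ρ).compAlternatingMap (g - wedge ρ δ) =
          (D ρ).compAlternatingMap g - (D ρ).compAlternatingMap (wedge ρ δ) := by
        ext v
        simp
      rw [koszulD_sub, hdg, wedge_koszulD, hδβ', hsub, hcomm, wedge_sub ρ _ (wedge ρ _),
        wedge_wedge, wedge_sub, hωβ]
      abel

/-- The Koszul complex has no cohomology in the degrees `0 < p < r`, by induction on `r`. Write
`ω = α + dx^r ∧ β` with `α`, `β` free of `dx^r`, and let `d` be the differential in the directions
`μ < r`. That `ω` is closed means that `d α = 0` and `D_r α = d β`. If the degree of `α` is `r`, the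
second equation makes the coefficient of `α` a sum of derivatives by `hreg`, so `α = d γ` in all
cases. Then `β - D_r γ` is closed. It is `d δ` if it has positive degree, and `D_r c` with `d c = 0`
by `hcoreg` if it has degree zero, so that `γ - dx^r ∧ δ` or `γ + c` is a primitive of `ω`. -/
theorem koszul_exact {D : Fin n → Module.End ℝ A}
    (hcomm : ∀ μ ν a, D μ (D ν a) = D ν (D μ a))
    (hreg : ∀ r : Fin n, 0 < r.1 → ∀ a, D r a ∈ rangeBelow D r → a ∈ rangeBelow D r)
    (hcoreg : ∀ r : Fin n, 0 < r.1 → ∀ b, (∀ s, s < r → D s b = 0) →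
      ∃ c, D r c = b ∧ ∀ s, s < r → D s c = 0)
    {r p : ℕ} (hr : r ≤ n) (hp : p + 1 < r) {ω : Form n A (p + 1)} (hω : Involves r ω)
    (hd : koszulD (initial D r) ω = 0) :
    ∃ η : Form n A p, Involves r η ∧ koszulD (initial D r) η = ω := by
  induction r generalizing p with
  | zero => omega
  | succ r ih =>
    have hr' := Nat.le_of_succ_le hr
    set ρ : Fin n := ⟨r, hr⟩ with hρ
    have hω' : Involves (ρ + 1 : ℕ) ω := hω
    have hinit : ∀ μ a, D ρ (initial D r μ a) = initial D r μ (D ρ a) := by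
      intro μ a
      by_cases h : μ.1 < r
      · simp [initial, h, hcomm]
      · simp [initial, h]
    have hsingle : ∀ μ a, D ρ ((Pi.single ρ 1 : Fin n → Module.End ℝ A) μ a) =
        (Pi.single ρ 1 : Fin n → Module.End ℝ A) μ (D ρ a) := by
      intro μ a
      rcases eq_or_ne μ ρ with rfl | hμ
      · simp
      · simp [Pi.single_eq_of_ne hμ]
    have hsplit : ∀ {q : ℕ} (θ : Form n A q), koszulD (initial D (r + 1)) θ =
        koszulD (initial D r) θ + wedge ρ ((D ρ).compAlternatingMap θ) :=
      fun θ => koszulD_initial_succ D ρ θ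
    have hwedge : ∀ {q : ℕ} (θ : Form n A q), koszulD (initial D (r + 1)) (wedge ρ θ) =
        -wedge ρ (koszulD (initial D r) θ) := by
      intro q θ
      rw [hsplit, wedge_koszulD,
        show (D ρ).compAlternatingMap (wedge ρ θ) = wedge ρ ((D ρ).compAlternatingMap θ) from
          comp_koszulD hsingle θ, wedge_wedge, add_zero]
    set β := contract ρ ω with hβ
    have hβr : Involves r β := hω'.contract
    set α := ω - wedge ρ β with hα
    have hαr : Involves r α := hω'.sub_wedge_contract
    have hωα : ω = α + wedge ρ β := by rw [hα, sub_add_cancel]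
    have hX : Involves r ((D ρ).compAlternatingMap α - koszulD (initial D r) β) :=
      (hαr.comp _).sub (hβr.koszulD D)
    have h0 : koszulD (initial D r) α +
        wedge ρ ((D ρ).compAlternatingMap α - koszulD (initial D r) β) = 0 := by
      rw [hωα, koszulD_add, hsplit, hwedge] at hd
      rw [wedge_sub, ← hd]
      abel
    -- `d α` is free of `dx^r`, so both summands of `h0` vanish.
    have hX0 : (D ρ).compAlternatingMap α - koszulD (initial D r) β = 0 := by
      have h1 := congrArg (contract ρ) h0
      rwa [contract_add, (hαr.koszulD D) ρ le_rfl, zero_add,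
        Involves.contract_wedge (r := ρ) hX] at h1
    have hdα : koszulD (initial D r) α = 0 := by
      rwa [hX0, wedge_zero, add_zero] at h0
    have hDα : (D ρ).compAlternatingMap α = koszulD (initial D r) β := sub_eq_zero.1 hX0
    obtain ⟨γ, hγ, hγα⟩ : ∃ γ : Form n A p, Involves r γ ∧ koszulD (initial D r) γ = α := by
      rcases Nat.lt_or_ge (p + 1) r with h | h
      · exact ih hr' h hαr hdα
      · obtain rfl : r = p + 1 := by omega
        refine exact_of_topCoeff_mem hr' hαr (hreg ρ (Nat.succ_pos p) _ ?_)
        have h1 : D ρ (topCoeff hr' α) = topCoeff hr' ((D ρ).compAlternatingMap α) := rfl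
        rw [h1, hDα]
        exact topCoeff_koszulD_mem D hr' _ β
    have hYr : Involves r (β - (D ρ).compAlternatingMap γ) := hβr.sub (hγ.comp _)
    have hY : koszulD (initial D r) (β - (D ρ).compAlternatingMap γ) = 0 := by
      rw [koszulD_sub, ← hDα, ← comp_koszulD hinit, hγα, sub_self]
    cases p with
    | zero =>
      set y := (β - (D ρ).compAlternatingMap γ) ![] with hy
      obtain ⟨c, hc, hc'⟩ := hcoreg ρ (by change 0 < r; omega) y fun s hs => by
        have h1 := congrArg (fun θ => contract s θ ![]) hY
        simp only [contract_koszulD_zero, initial, if_pos (show s.1 < r from hs)] at h1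
        exact h1
      set κ : Form n A 0 := AlternatingMap.constOfIsEmpty ℝ _ _ c with hκ
      have hκd : koszulD (initial D r) κ = 0 := by
        refine form_ext fun μ => ?_
        rw [contract_koszulD_zero]
        by_cases h : μ.1 < r
        · rw [initial, if_pos h]
          exact form_zero_ext (hc' μ h)
        · rw [initial, if_neg h]
          rfl
      have hκβ : (D ρ).compAlternatingMap κ = β - (D ρ).compAlternatingMap γ :=
        form_zero_ext hc
      refine ⟨γ + κ, trivial, ?_⟩
      rw [koszulD_add, hsplit, hsplit, hγα, hκd, hκβ, hωα, zero_add (wedge _ _),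
        add_assoc, ← wedge_add, add_sub_cancel]
    | succ p =>
      obtain ⟨δ, hδ, hδY⟩ := ih hr' (by omega) hYr hY
      refine ⟨γ - wedge ρ δ, (hγ.mono (Nat.le_succ r)).sub (Involves.wedge (r := ρ) hδ), ?_⟩
      rw [koszulD_sub, hsplit, hwedge, hγα, hδY, hωα, wedge_sub]
      abel

end Koszul

/-! ### Polynomial symbols of differential operators -/

section Symbols

variable {n : ℕ} {A : Type*} [AddCommGroup A] [Module ℝ A]

theorem MultiIndex.append_apply_self (I : MultiIndex n) (s : Fin n) : I.append s s = I s + 1 := by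
  simp [MultiIndex.append]

theorem MultiIndex.append_apply_of_ne (I : MultiIndex n) {s μ : Fin n} (h : μ ≠ s) :
    I.append s μ = I μ := by
  simp [MultiIndex.append, h]

theorem MultiIndex.append_injective (s : Fin n) :
    Function.Injective fun I : MultiIndex n => I.append s :=
  fun _ _ h => add_right_cancel h

theorem MultiIndex.length_append (I : MultiIndex n) (s : Fin n) :
    (I.append s).length = I.length + 1 := by
  simp [MultiIndex.length, MultiIndex.append, Finset.sum_add_distrib]

theorem MultiIndex.exists_append {I : MultiIndex n} {s : Fin n} (h : I s ≠ 0) :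
    ∃ J : MultiIndex n, I = J.append s := by
  refine ⟨I - Pi.single s 1, funext fun μ => ?_⟩
  rcases eq_or_ne μ s with rfl | hμ
  · simp [MultiIndex.append]
    omega
  · simp [MultiIndex.append, hμ]

theorem MultiIndex.induction {P : MultiIndex n → Prop} (zero : P 0)
    (append : ∀ I s, P I → P (I.append s)) (I : MultiIndex n) : P I := by
  induction hl : I.length generalizing I with
  | zero =>
    have : I = 0 := by
      funext μ
      exact Finset.sum_eq_zero_iff.1 hl μ (Finset.mem_univ μ)
    rwa [this]
  | succ l ih =>
    obtain ⟨s, hs⟩ : ∃ s, I s ≠ 0 := by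
      by_contra! h
      simp [MultiIndex.length, h] at hl
    obtain ⟨J, rfl⟩ := MultiIndex.exists_append hs
    rw [MultiIndex.length_append] at hl
    exact append J s (ih J (by omega))

/-- The monomial `T^I = T_0^{I_0} ⋯ T_{n-1}^{I_{n-1}}` in a family of operators. -/
def opPow (T : Fin n → Module.End ℝ A) (I : MultiIndex n) : Module.End ℝ A :=
  (List.ofFn fun μ => T μ ^ I μ).prod

theorem opPow_zero (T : Fin n → Module.End ℝ A) : opPow T 0 = 1 := by
  simp [opPow]

theorem opPow_append {T : Fin n → Module.End ℝ A} (hT : ∀ μ ν, Commute (T μ) (T ν))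
    (I : MultiIndex n) (s : Fin n) : opPow T (I.append s) = T s * opPow T I := by
  unfold opPow
  induction n with
  | zero => exact s.elim0
  | succ n ih =>
    rw [List.ofFn_succ, List.ofFn_succ, List.prod_cons, List.prod_cons]
    refine Fin.cases ?_ (fun s => ?_) s
    · rw [MultiIndex.append_apply_self, pow_succ', mul_assoc]
      congr 4
    · rw [MultiIndex.append_apply_of_ne _ (Fin.succ_ne_zero s).symm]
      have h := ih (T := fun μ => T μ.succ) (fun μ ν => hT _ _) (fun μ => I μ.succ) s
      have h1 : (fun μ : Fin n => T μ.succ ^ I.append s.succ μ.succ) =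
          fun μ => T μ.succ ^ MultiIndex.append (fun μ => I μ.succ) s μ := by
        funext μ
        congr 1
        rcases eq_or_ne μ s with rfl | hμ
        · simp only [MultiIndex.append_apply_self]
        · rw [MultiIndex.append_apply_of_ne _ hμ,
            MultiIndex.append_apply_of_ne _ fun h => hμ (Fin.succ_injective _ h)]
      rw [h1, h, ← mul_assoc, ← mul_assoc, ((hT 0 s.succ).pow_left (I 0)).eq]

theorem opPow_intertwine {B : Type*} [AddCommGroup B] [Module ℝ B] {T : Fin n → Module.End ℝ A}
    {U : Fin n → Module.End ℝ B} (hT : ∀ μ ν, Commute (T μ) (T ν))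
    (hU : ∀ μ ν, Commute (U μ) (U ν)) {G : A →ₗ[ℝ] B} (h : ∀ s a, G (T s a) = U s (G a))
    (I : MultiIndex n) (a : A) : G (opPow T I a) = opPow U I (G a) := by
  induction I using MultiIndex.induction with
  | zero => simp [opPow_zero]
  | append I s ih =>
    rw [opPow_append hT, opPow_append hU, Module.End.mul_apply, Module.End.mul_apply, h, ih]

/-- The polynomials `∑_I a_I X^I` in `n` commuting variables with coefficients in `A`. The
polynomial stands for the differential operator with the coefficients `a_I`. -/
abbrev Symbol (n : ℕ) (A : Type*) [AddCommGroup A] : Type _ := MultiIndex n →₀ A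

/-- Multiplication of polynomials by `X_s`. -/
def mulX (s : Fin n) : Module.End ℝ (Symbol n A) :=
  Finsupp.lmapDomain A ℝ fun I : MultiIndex n => I.append s

/-- An operator acting on the coefficients of polynomials. -/
def onCoeffs (T : Module.End ℝ A) : Module.End ℝ (Symbol n A) := Finsupp.mapRange.linearMap T

theorem mulX_single (s : Fin n) (I : MultiIndex n) (a : A) :
    mulX s (Finsupp.single I a) = Finsupp.single (I.append s) a := by
  simp [mulX, Finsupp.mapDomain_single]

theorem onCoeffs_single (T : Module.End ℝ A) (I : MultiIndex n) (a : A) :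
    onCoeffs T (Finsupp.single I a) = Finsupp.single I (T a) := by
  simp [onCoeffs]

theorem onCoeffs_apply (T : Module.End ℝ A) (u : Symbol n A) (I : MultiIndex n) :
    onCoeffs T u I = T (u I) := by
  simp [onCoeffs]

theorem mulX_apply_append (s : Fin n) (u : Symbol n A) (I : MultiIndex n) :
    mulX s u (I.append s) = u I :=
  Finsupp.mapDomain_apply (MultiIndex.append_injective s) u I

theorem mulX_apply_of_eq_zero {s : Fin n} {I : MultiIndex n} (h : I s = 0) (u : Symbol n A) :
    mulX s u I = 0 := by
  refine Finsupp.mapDomain_of_notMem_range u I ?_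
  rintro ⟨J, rfl⟩
  simp only [MultiIndex.append_apply_self] at h
  omega

theorem commute_mulX (s t : Fin n) : Commute (mulX s : Module.End ℝ (Symbol n A)) (mulX t) := by
  refine Finsupp.lhom_ext fun I a => ?_
  rw [Module.End.mul_apply, Module.End.mul_apply, mulX_single, mulX_single, mulX_single,
    mulX_single]
  congr 1
  exact add_right_comm _ _ _

theorem commute_mulX_onCoeffs (s : Fin n) (T : Module.End ℝ A) :
    Commute (mulX s : Module.End ℝ (Symbol n A)) (onCoeffs T) := by
  refine Finsupp.lhom_ext fun I a => ?_
  rw [Module.End.mul_apply, Module.End.mul_apply, mulX_single, onCoeffs_single, mulX_single,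
    onCoeffs_single]

theorem commute_onCoeffs {T U : Module.End ℝ A} (h : Commute T U) :
    Commute (onCoeffs T : Module.End ℝ (Symbol n A)) (onCoeffs U) := by
  refine Finsupp.lhom_ext fun I a => ?_
  rw [Module.End.mul_apply, Module.End.mul_apply, onCoeffs_single, onCoeffs_single,
    onCoeffs_single, onCoeffs_single]
  exact congrArg _ (LinearMap.congr_fun h.eq a)

/-- The polynomials over `A` are freely generated by the constants under multiplication by the
variables. -/
theorem symbol_hom_ext {B : Type*} [AddCommGroup B] [Module ℝ B] {T : Fin n → Module.End ℝ B}
    {G G' : Symbol n A →ₗ[ℝ] B} (hG : ∀ s u, G (mulX s u) = T s (G u))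
    (hG' : ∀ s u, G' (mulX s u) = T s (G' u))
    (h : ∀ a, G (Finsupp.single 0 a) = G' (Finsupp.single 0 a)) : G = G' := by
  refine Finsupp.lhom_ext fun I a => ?_
  induction I using MultiIndex.induction with
  | zero => exact h a
  | append I s ih => rw [← mulX_single, hG, hG', ih]

/-- The substitution `∑_I a_I X^I ↦ ∑_I T^I a_I`, operators `T_s` on polynomials being applied
to constants. -/
def substitute (T : Fin n → Module.End ℝ (Symbol n A)) : Module.End ℝ (Symbol n A) :=
  Finsupp.lsum ℝ fun I => opPow T I ∘ₗ Finsupp.lsingle 0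

theorem substitute_single (T : Fin n → Module.End ℝ (Symbol n A)) (I : MultiIndex n) (a : A) :
    substitute T (Finsupp.single I a) = opPow T I (Finsupp.single 0 a) := by
  simp [substitute]

theorem substitute_single_zero (T : Fin n → Module.End ℝ (Symbol n A)) (a : A) :
    substitute T (Finsupp.single 0 a) = Finsupp.single 0 a := by
  rw [substitute_single, opPow_zero]
  rfl

theorem substitute_mulX {T : Fin n → Module.End ℝ (Symbol n A)}
    (hT : ∀ μ ν, Commute (T μ) (T ν)) (s : Fin n) (u : Symbol n A) :
    substitute T (mulX s u) = T s (substitute T u) := by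
  have h : substitute T ∘ₗ mulX s = T s ∘ₗ substitute T := by
    refine Finsupp.lhom_ext fun I a => ?_
    rw [LinearMap.comp_apply, LinearMap.comp_apply, mulX_single, substitute_single,
      substitute_single, opPow_append hT, Module.End.mul_apply]
  exact LinearMap.congr_fun h u

theorem substitute_onCoeffs {T : Fin n → Module.End ℝ (Symbol n A)}
    (hT : ∀ μ ν, Commute (T μ) (T ν)) {S : Module.End ℝ A}
    (hS : ∀ μ, Commute (onCoeffs S) (T μ)) (u : Symbol n A) :
    substitute T (onCoeffs S u) = onCoeffs S (substitute T u) := by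
  have h : substitute T ∘ₗ onCoeffs S = onCoeffs S ∘ₗ substitute T := by
    refine Finsupp.lhom_ext fun I a => ?_
    rw [LinearMap.comp_apply, LinearMap.comp_apply, onCoeffs_single, substitute_single,
      substitute_single, opPow_intertwine hT hT (G := onCoeffs S)
        (fun s u => LinearMap.congr_fun (hS s).eq u), onCoeffs_single]
  exact LinearMap.congr_fun h u

variable {D : Fin n → Module.End ℝ A}

/-- The operators `X_s + D_s` on polynomials. -/
def plusOp (D : Fin n → Module.End ℝ A) (s : Fin n) : Module.End ℝ (Symbol n A) :=
  mulX s + onCoeffs (D s)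

/-- The operators `X_s - D_s` on polynomials. -/
def minusOp (D : Fin n → Module.End ℝ A) : Fin n → Module.End ℝ (Symbol n A) :=
  plusOp fun s => -D s

theorem minusOp_apply (D : Fin n → Module.End ℝ A) (s : Fin n) (u : Symbol n A) :
    minusOp D s u = mulX s u - onCoeffs (D s) u := by
  rw [minusOp, plusOp, LinearMap.add_apply, sub_eq_add_neg]
  congr 1
  ext I
  simp [onCoeffs_apply]

theorem commute_plusOp (hD : ∀ μ ν, Commute (D μ) (D ν)) (μ ν : Fin n) :
    Commute (plusOp D μ) (plusOp D ν) :=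
  ((commute_mulX μ ν).add_right (commute_mulX_onCoeffs μ _)).add_left
    ((commute_mulX_onCoeffs ν _).symm.add_right (commute_onCoeffs (hD μ ν)))

theorem commute_minusOp (hD : ∀ μ ν, Commute (D μ) (D ν)) (μ ν : Fin n) :
    Commute (minusOp D μ) (minusOp D ν) :=
  commute_plusOp (fun μ ν => (hD μ ν).neg_left.neg_right) μ ν

theorem commute_onCoeffs_plusOp {S : Module.End ℝ A} (h : ∀ μ, Commute S (D μ)) (μ : Fin n) :
    Commute (onCoeffs S) (plusOp D μ) :=
  (commute_mulX_onCoeffs μ S).symm.add_right (commute_onCoeffs (h μ))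

theorem commute_onCoeffs_minusOp {S : Module.End ℝ A} (h : ∀ μ, Commute S (D μ)) (μ : Fin n) :
    Commute (onCoeffs S) (minusOp D μ) :=
  commute_onCoeffs_plusOp (fun μ => (h μ).neg_right) μ

theorem substitute_minusOp_plusOp (hD : ∀ μ ν, Commute (D μ) (D ν)) (s : Fin n)
    (u : Symbol n A) :
    substitute (minusOp D) (plusOp D s u) = mulX s (substitute (minusOp D) u) := by
  rw [plusOp, LinearMap.add_apply, map_add, substitute_mulX (commute_minusOp hD),
    substitute_onCoeffs (commute_minusOp hD) (commute_onCoeffs_minusOp (hD s)),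
    minusOp_apply, sub_add_cancel]

theorem substitute_plusOp_minusOp (hD : ∀ μ ν, Commute (D μ) (D ν)) (s : Fin n)
    (u : Symbol n A) :
    substitute (plusOp D) (minusOp D s u) = mulX s (substitute (plusOp D) u) := by
  rw [minusOp_apply, map_sub, substitute_mulX (commute_plusOp hD),
    substitute_onCoeffs (commute_plusOp hD) (commute_onCoeffs_plusOp (hD s)), plusOp,
    LinearMap.add_apply, add_sub_cancel_right]

/-- The substitutions `X ↦ X + D` and `X ↦ X - D` are inverse to each other. -/
theorem substitute_plusOp_substitute_minusOp (hD : ∀ μ ν, Commute (D μ) (D ν))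
    (u : Symbol n A) : substitute (plusOp D) (substitute (minusOp D) u) = u := by
  have h : substitute (plusOp D) ∘ₗ substitute (minusOp D) = LinearMap.id := by
    refine symbol_hom_ext (T := mulX) (fun s u => ?_) (fun s u => rfl) fun a => ?_
    · rw [LinearMap.comp_apply, substitute_mulX (commute_minusOp hD),
        substitute_plusOp_minusOp hD]
      rfl
    · rw [LinearMap.comp_apply, substitute_single_zero, substitute_single_zero]
      rfl
  exact LinearMap.congr_fun h u

/-- The constant term of the substitution `X ↦ X - D` is the formal adjoint
`∑_I (-1)^{|I|} D^I a_I`. -/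
theorem substitute_minusOp_apply_zero (hD : ∀ μ ν, Commute (D μ) (D ν)) (u : Symbol n A) :
    substitute (minusOp D) u 0 = u.sum fun I a => (-1 : ℝ) ^ I.length • opPow D I a := by
  let G : Symbol n A →ₗ[ℝ] A := Finsupp.lapply 0 ∘ₗ substitute (minusOp D)
  let G' : Symbol n A →ₗ[ℝ] A := Finsupp.lsum ℝ fun I => (-1 : ℝ) ^ I.length • opPow D I
  have h : G = G' := by
    refine symbol_hom_ext (T := fun s => -D s) (fun s u => ?_) (fun s u => ?_) fun a => ?_
    · change substitute (minusOp D) (mulX s u) 0 = -D s (substitute (minusOp D) u 0)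
      rw [substitute_mulX (commute_minusOp hD), minusOp_apply, Finsupp.sub_apply,
        mulX_apply_of_eq_zero rfl, onCoeffs_apply, zero_sub]
    · have h1 : G' ∘ₗ mulX s = (-D s) ∘ₗ G' := by
        refine Finsupp.lhom_ext fun I a => ?_
        rw [LinearMap.comp_apply, LinearMap.comp_apply, mulX_single]
        simp only [G', Finsupp.lsum_single, LinearMap.smul_apply, LinearMap.neg_apply,
          map_smul, opPow_append hD, Module.End.mul_apply, MultiIndex.length_append, pow_succ,
          mul_neg_one, neg_smul, smul_neg]
      exact LinearMap.congr_fun h1 u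
    · change substitute (minusOp D) (Finsupp.single 0 a) 0 = _
      simp [G', substitute_single_zero, opPow_zero, MultiIndex.length]
  exact LinearMap.congr_fun h u

end Symbols

/-! ### The calculus of local functions -/

section Calculus

open scoped ContDiff

variable {n m : ℕ}

theorem localFunction_ext {f g : LocalFunction n m} (h : ∀ z, f.1 z = g.1 z) : f = g :=
  Subtype.ext (funext h)

theorem directional_apply {k : ℕ} {f : LocalFunction n m} {g : FiniteJet n m k → ℝ}
    (hg : ContDiff ℝ ∞ g) (hfg : ∀ z, f.1 z = g (truncate n m k z)) (v z : Jet n m) :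
    (directional v f).1 z = fderiv ℝ g (truncate n m k z) (truncate n m k v) :=
  (lineDeriv_of_eq hg hfg z v).lineDeriv

theorem totalDeriv_mul (ν : Fin n) (f g : LocalFunction n m) :
    totalDeriv ν (f * g) = totalDeriv ν f * g + f * totalDeriv ν g := by
  obtain ⟨k, hk⟩ := f.2
  obtain ⟨l, hl⟩ := g.2
  obtain ⟨F, hF, hfF⟩ := hk.mono (le_max_left k l)
  obtain ⟨G, hG, hgG⟩ := hl.mono (le_max_right k l)
  refine localFunction_ext fun z => ?_
  have h1 := totalDeriv_apply (f := f * g) (g := fun y => F y * G y) (hF.mul hG)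
    (fun z => by
      change f.1 z * g.1 z = _
      rw [hfF, hgG]) ν z
  have h2 := totalDeriv_apply hF hfF ν z
  have h3 := totalDeriv_apply hG hgG ν z
  rw [h1, fderiv_fun_mul (hF.differentiable (by simp) _) (hG.differentiable (by simp) _)]
  change _ = (totalDeriv ν f).1 z * g.1 z + f.1 z * (totalDeriv ν g).1 z
  rw [h2, h3, hfF, hgG]
  simp only [add_apply, smul_apply, smul_eq_mul]
  ring

theorem totalDeriv_phi (ν : Fin n) (i : Fin m) (I : MultiIndex n) :
    totalDeriv ν (phi i I) = phi (n := n) i (I.append ν) := by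
  refine localFunction_ext fun z => ?_
  let L : FiniteJet n m I.length →L[ℝ] ℝ :=
    (ContinuousLinearMap.proj (i, ⟨I, mem_multiIndices.2 le_rfl⟩)).comp
      (ContinuousLinearMap.snd ℝ _ _)
  rw [totalDeriv_apply (g := L) L.contDiff (fun _ => rfl), L.fderiv]
  rfl

/-- The commutator of `∂_ν` with the derivative in a fixed direction. -/
theorem directional_totalDeriv (v : Jet n m) (ν : Fin n) (f : LocalFunction n m) :
    directional v (totalDeriv ν f) = totalDeriv ν (directional v f) +
      directional (0, fun a => v.2 (a.1, a.2.append ν)) f := by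
  obtain ⟨k, g, hg, hfg⟩ := f.2
  have hg1 : ContDiff ℝ ∞ (fderiv ℝ g) := hg.fderiv_right (m := ∞) (by simp)
  refine localFunction_ext fun z => ?_
  let G : FiniteJet n m (k + 1) → ℝ := fun y =>
    fderiv ℝ g (lower n m k y) ((Pi.single ν 1, 0) + shift n m k ν y)
  have hG : ContDiff ℝ ∞ G :=
    (hg1.comp (lower n m k).contDiff).clm_apply
      (contDiff_const.add (shift n m k ν).contDiff)
  have hfG : ∀ z, (totalDeriv ν f).1 z = G (truncate n m (k + 1) z) := by
    intro z
    rw [totalDeriv_apply hg hfg, truncate_totalDirection]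
    rfl
  have hd : HasFDerivAt G _ (truncate n m (k + 1) z) :=
    HasFDerivAt.clm_apply
      (((hg1.differentiable (by simp)) _).hasFDerivAt.comp _ (lower n m k).hasFDerivAt)
      ((shift n m k ν).hasFDerivAt.const_add (Pi.single ν 1, 0))
  have hsymm : IsSymmSndFDerivAt ℝ g (truncate n m k z) :=
    hg.contDiffAt.isSymmSndFDerivAt (by
      rw [minSmoothness_of_isRCLikeNormedField]
      exact WithTop.coe_le_coe.2 le_top)
  have h1 : (totalDeriv ν (directional v f)).1 z =
      fderiv ℝ (fderiv ℝ g) (truncate n m k z) (truncate n m k (totalDirection ν z))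
        (truncate n m k v) := by
    rw [totalDeriv_apply (g := fun y => fderiv ℝ g y (truncate n m k v))
      (hg1.clm_apply contDiff_const) (directional_apply hg hfg v)]
    have := ((hg1.differentiable (by simp)) (truncate n m k z)).hasFDerivAt.clm_apply
      (hasFDerivAt_const (truncate n m k v) _)
    rw [this.fderiv]
    simp
  change _ = (totalDeriv ν (directional v f)).1 z + (directional _ f).1 z
  rw [directional_apply hG hfG, hd.fderiv, h1, directional_apply hg hfg, hsymm.eq,
    truncate_totalDirection]
  simp only [add_apply, ContinuousLinearMap.comp_apply, ContinuousLinearMap.flip_apply]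
  rw [add_comm]
  congr 2

theorem partialPhi_totalDeriv_append (i : Fin m) (I : MultiIndex n) (ν : Fin n)
    (f : LocalFunction n m) : partialPhi i (I.append ν) (totalDeriv ν f) =
      totalDeriv ν (partialPhi i (I.append ν) f) + partialPhi i I f := by
  unfold partialPhi
  rw [directional_totalDeriv]
  congr 3
  refine Prod.ext rfl (funext fun a => ?_)
  by_cases h : a = (i, I)
  · subst h
    simp
  · have h' : (a.1, a.2.append ν) ≠ (i, I.append ν) := fun h1 =>
      h (Prod.ext (congrArg (fun b => b.1) h1)
        (MultiIndex.append_injective ν (congrArg (fun b => b.2) h1)))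
    simp [Pi.single_eq_of_ne h, Pi.single_eq_of_ne h']

theorem partialPhi_totalDeriv_of_eq_zero (i : Fin m) {I : MultiIndex n} {ν : Fin n}
    (hI : I ν = 0) (f : LocalFunction n m) :
    partialPhi i I (totalDeriv ν f) = totalDeriv ν (partialPhi i I f) := by
  unfold partialPhi
  rw [directional_totalDeriv, add_eq_left]
  have h0 : ((0, fun a => (Pi.single (i, I) 1 : Fin m × MultiIndex n → ℝ) (a.1, a.2.append ν)) :
      Jet n m) = 0 := by
    refine Prod.ext rfl (funext fun a => Pi.single_eq_of_ne (fun h => ?_) _)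
    have h2 := congrFun (congrArg (fun b => b.2) h) ν
    simp only [MultiIndex.append_apply_self, hI] at h2
    omega
  obtain ⟨k, g, hg, hfg⟩ := f.2
  refine localFunction_ext fun z => ?_
  have h := directional_apply hg hfg (0 : Jet n m) z
  rw [map_zero, map_zero] at h
  exact (congrArg (fun v => (directional v f).1 z) h0).trans h

theorem commute_totalDeriv (μ ν : Fin n) :
    Commute (totalDeriv μ : Module.End ℝ (LocalFunction n m)) (totalDeriv ν) :=
  LinearMap.ext fun f => totalDeriv_comm μ ν f

/-! ### Higher Euler operators -/

/-- The linearization `∑_I (∂f/∂φ^i_I) X^I` of a local function. -/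
def linearization (i : Fin m) : LocalFunction n m →ₗ[ℝ] Symbol n (LocalFunction n m) where
  toFun f := Finsupp.ofSupportFinite (fun I => partialPhi i I f)
    (((finite_support_partialPhi f).image Prod.snd).subset fun I hI => ⟨(i, I), hI, rfl⟩)
  map_add' f g := Finsupp.ext fun I => map_add (partialPhi i I) f g
  map_smul' c f := Finsupp.ext fun I => map_smul (partialPhi i I) c f

theorem linearization_apply (i : Fin m) (f : LocalFunction n m) (I : MultiIndex n) :
    linearization i f I = partialPhi i I f := rfl

theorem linearization_totalDeriv (i : Fin m) (ν : Fin n) (f : LocalFunction n m) :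
    linearization i (totalDeriv ν f) = plusOp totalDeriv ν (linearization i f) := by
  refine Finsupp.ext fun I => ?_
  rw [plusOp, LinearMap.add_apply, Finsupp.add_apply, onCoeffs_apply, linearization_apply,
    linearization_apply]
  by_cases h : I ν = 0
  · rw [mulX_apply_of_eq_zero h, zero_add, partialPhi_totalDeriv_of_eq_zero i h]
  · obtain ⟨J, rfl⟩ := MultiIndex.exists_append h
    rw [mulX_apply_append, partialPhi_totalDeriv_append, add_comm]
    rfl

/-- The higher Euler operators
`f ↦ ∑_{I ≥ J} (-1)^{|I| - |J|} (I choose J) ∂_{I - J} (∂f/∂φ^i_I)`, for all `J` at once, as the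
coefficients of the polynomial that arises from the linearization by the substitution
`X ↦ X - ∂`. -/
def higherEuler (i : Fin m) : LocalFunction n m →ₗ[ℝ] Symbol n (LocalFunction n m) :=
  substitute (minusOp totalDeriv) ∘ₗ linearization i

theorem higherEuler_totalDeriv (i : Fin m) (ν : Fin n) (f : LocalFunction n m) :
    higherEuler i (totalDeriv ν f) = mulX ν (higherEuler i f) := by
  rw [higherEuler, LinearMap.comp_apply, linearization_totalDeriv,
    substitute_minusOp_plusOp commute_totalDeriv]
  rfl

theorem substitute_higherEuler (i : Fin m) (f : LocalFunction n m) :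
    substitute (plusOp totalDeriv) (higherEuler i f) = linearization i f :=
  substitute_plusOp_substitute_minusOp commute_totalDeriv _

theorem higherEuler_apply_zero (i : Fin m) (f : LocalFunction n m) :
    higherEuler i f 0 = eulerLagrange i f := by
  rw [higherEuler, LinearMap.comp_apply, substitute_minusOp_apply_zero commute_totalDeriv]
  refine (finsum_eq_sum_of_support_subset (fun I : MultiIndex n =>
    ((-1 : ℝ) ^ I.length • (iteratedTotalDeriv I ∘ₗ partialPhi i I)) f) fun I hI => ?_).symm
  rw [Finset.mem_coe, Finsupp.mem_support_iff, linearization_apply]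
  intro h
  exact hI (by simp [h])

/-- The pairing `∑_I a_I X^I ↦ ∑_I φ^i_I a_I`, the value of a differential operator on `φ^i`. -/
def pairing (i : Fin m) : Symbol n (LocalFunction n m) →ₗ[ℝ] LocalFunction n m :=
  Finsupp.lsum ℝ fun I => LinearMap.mulLeft ℝ (phi i I)

theorem pairing_single (i : Fin m) (I : MultiIndex n) (a : LocalFunction n m) :
    pairing i (Finsupp.single I a) = phi i I * a := by
  simp [pairing]

theorem pairing_plusOp (i : Fin m) (ν : Fin n) (u : Symbol n (LocalFunction n m)) :
    pairing i (plusOp totalDeriv ν u) = totalDeriv ν (pairing i u) := by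
  have h : pairing i ∘ₗ plusOp totalDeriv ν = totalDeriv (m := m) ν ∘ₗ pairing i := by
    refine Finsupp.lhom_ext fun I a => ?_
    rw [LinearMap.comp_apply, LinearMap.comp_apply, plusOp, LinearMap.add_apply, mulX_single,
      onCoeffs_single, map_add, pairing_single, pairing_single, pairing_single, totalDeriv_mul,
      totalDeriv_phi]
  exact LinearMap.congr_fun h u

/-- Integration by parts: `∑_I φ_I a_I = ∑_J ∂_J (φ b_J)` if `∑_I a_I X^I` arises from
`∑_J b_J X^J` by the substitution `X ↦ X + ∂`. -/
theorem pairing_substitute (i : Fin m) (u : Symbol n (LocalFunction n m)) :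
    pairing i (substitute (plusOp totalDeriv) u) =
      u.sum fun J b => opPow totalDeriv J (phi i 0 * b) := by
  let G : Symbol n (LocalFunction n m) →ₗ[ℝ] LocalFunction n m :=
    Finsupp.lsum ℝ fun J => opPow totalDeriv J ∘ₗ LinearMap.mulLeft ℝ (phi i 0)
  have h : pairing i ∘ₗ substitute (plusOp totalDeriv) = G := by
    refine Finsupp.lhom_ext fun I a => ?_
    rw [LinearMap.comp_apply, substitute_single,
      opPow_intertwine (commute_plusOp commute_totalDeriv) commute_totalDeriv (pairing_plusOp i),
      pairing_single]
    simp [G]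
  exact LinearMap.congr_fun h u

end Calculus

/-! ### Contraction of the fibres -/

section FiberContraction

open scoped ContDiff
open MeasureTheory

variable {n m : ℕ}

theorem contDiff_scale {k : ℕ} {g : FiniteJet n m k → ℝ} (hg : ContDiff ℝ ∞ g) :
    ContDiff ℝ ∞ (Function.uncurry fun (y : FiniteJet n m k) (t : ℝ) => g (y.1, t • y.2)) := by
  refine hg.comp ?_
  fun_prop

theorem fderiv_scale {k : ℕ} {g : FiniteJet n m k → ℝ} (hg : ContDiff ℝ ∞ g) (t : ℝ)
    (y v : FiniteJet n m k) :
    fderiv ℝ (fun y : FiniteJet n m k => g (y.1, t • y.2)) y v =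
      fderiv ℝ g (y.1, t • y.2) (v.1, t • v.2) := by
  let Λ : FiniteJet n m k →L[ℝ] FiniteJet n m k :=
    (ContinuousLinearMap.fst ℝ _ _).prod (t • ContinuousLinearMap.snd ℝ _ _)
  have h := ((hg.differentiable (by simp)) (Λ y)).hasFDerivAt.comp y Λ.hasFDerivAt
  exact congrArg (fun L => L v) h.fderiv

theorem continuous_scale (f : LocalFunction n m) (z : Jet n m) :
    Continuous fun t : ℝ => f.1 (z.1, t • z.2) := by
  obtain ⟨k, g, hg, hfg⟩ := f.2
  have h : (fun t : ℝ => f.1 (z.1, t • z.2)) =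
      fun t => g ((truncate n m k z).1, t • (truncate n m k z).2) := funext fun t => hfg _
  rw [h]
  exact (contDiff_scale hg).continuous.comp (Continuous.prodMk continuous_const continuous_id)

/-- The operator `f ↦ ∫₀¹ f(x, tφ) dt` on local functions. -/
def fiberAverage : LocalFunction n m →ₗ[ℝ] LocalFunction n m where
  toFun f := ⟨fun z => ∫ t in (0 : ℝ)..1, f.1 (z.1, t • z.2), by
    obtain ⟨k, g, hg, hfg⟩ := f.2
    exact ⟨k, _, contDiff_integral_parameter (contDiff_scale hg),
      fun z => intervalIntegral.integral_congr fun t _ => hfg _⟩⟩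
  map_add' f g := localFunction_ext fun z =>
    intervalIntegral.integral_add ((continuous_scale f z).intervalIntegrable _ _)
      ((continuous_scale g z).intervalIntegrable _ _)
  map_smul' c f := localFunction_ext fun z =>
    intervalIntegral.integral_const_mul c fun t => f.1 (z.1, t • z.2)

theorem fiberAverage_apply (f : LocalFunction n m) (z : Jet n m) :
    (fiberAverage f).1 z = ∫ t in (0 : ℝ)..1, f.1 (z.1, t • z.2) := rfl

theorem commute_fiberAverage_totalDeriv (ν : Fin n) :
    Commute (fiberAverage : Module.End ℝ (LocalFunction n m)) (totalDeriv ν) := by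
  refine LinearMap.ext fun f => localFunction_ext fun z => ?_
  obtain ⟨k, g, hg, hfg⟩ := f.2
  have hH := contDiff_scale hg
  have h1 : (totalDeriv ν (fiberAverage f)).1 z = _ :=
    totalDeriv_apply (contDiff_integral_parameter hH)
      (fun z => intervalIntegral.integral_congr fun t _ => hfg _) ν z
  change (fiberAverage (totalDeriv ν f)).1 z = (totalDeriv ν (fiberAverage f)).1 z
  rw [h1, (hasFDerivAt_integral_parameter hH _).fderiv, fiberAverage_apply,
    ContinuousLinearMap.intervalIntegral_apply]
  · refine intervalIntegral.integral_congr fun t _ => ?_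
    rw [totalDeriv_apply hg hfg, fderiv_scale hg]
    rfl
  · refine Continuous.intervalIntegrable ?_ _ _
    exact (contDiff_fderiv_parameter hH).continuous.comp
      (Continuous.prodMk continuous_const continuous_id)

/-- A function of the base coordinates as a local function. -/
def ofBase (β : (Fin n → ℝ) → ℝ) (hβ : ContDiff ℝ ∞ β) : LocalFunction n m :=
  ⟨fun z => β z.1, 0, fun y => β y.1, hβ.comp contDiff_fst, fun _ => rfl⟩

theorem totalDeriv_ofBase_apply {β : (Fin n → ℝ) → ℝ} (hβ : ContDiff ℝ ∞ β) (ν : Fin n)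
    (z : Jet n m) :
    (totalDeriv ν (ofBase β hβ)).1 z = fderiv ℝ β z.1 (Pi.single ν 1) := by
  rw [totalDeriv_apply (k := 0) (g := fun y => β y.1) (hβ.comp contDiff_fst) (fun _ => rfl)]
  have h := ((hβ.differentiable (by simp)) z.1).hasFDerivAt.comp (truncate n m 0 z)
    (ContinuousLinearMap.fst ℝ (Fin n → ℝ) (Fin m × multiIndices n 0 → ℝ)).hasFDerivAt
  exact congrArg (fun L => L (truncate n m 0 (totalDirection ν z))) h.fderiv

theorem contDiff_zeroSection (f : LocalFunction n m) :
    ContDiff ℝ ∞ fun x : Fin n → ℝ => f.1 (x, 0) := by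
  obtain ⟨k, g, hg, hfg⟩ := f.2
  have h : (fun x : Fin n → ℝ => f.1 (x, 0)) = fun x => g (x, 0) := funext fun x => hfg _
  rw [h]
  exact hg.comp (contDiff_id.prodMk contDiff_const)

/-- The restriction of a local function to `φ = 0`. -/
def zeroSection (f : LocalFunction n m) : LocalFunction n m :=
  ofBase (fun x => f.1 (x, 0)) (contDiff_zeroSection f)

theorem pairing_onCoeffs_linearization_apply {k : ℕ} {f : LocalFunction n m}
    (hf : HasOrder k f.1) (i : Fin m) (z : Jet n m) :
    (pairing i (onCoeffs fiberAverage (linearization i f))).1 z =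
      ∑ I ∈ multiIndices n k, z.2 (i, I) * (fiberAverage (partialPhi i I f)).1 z := by
  have h : pairing i (onCoeffs fiberAverage (linearization i f)) =
      ∑ I ∈ multiIndices n k, phi i I * fiberAverage (partialPhi i I f) := by
    refine Finsupp.sum_of_support_subset _ (fun I hI => ?_) _ fun I _ => mul_zero _
    rw [Finsupp.mem_support_iff, onCoeffs_apply, linearization_apply] at hI
    rw [mem_multiIndices]
    by_contra hl
    exact hI (by rw [partialPhi_eq_zero hf i (not_le.1 hl), map_zero])
  rw [h]
  exact map_sum (evalAt z) _ _

/-- A local function is recovered from its linearization by integration along the fibres. -/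
theorem eq_zeroSection_add_pairing (f : LocalFunction n m) :
    f = zeroSection f + ∑ i, pairing i (onCoeffs fiberAverage (linearization i f)) := by
  refine localFunction_ext fun z => ?_
  obtain ⟨k, g, hg, hfg⟩ := f.2
  have hf : HasOrder k f.1 := ⟨g, hg, hfg⟩
  have hsum : (∑ i, pairing i (onCoeffs fiberAverage (linearization i f))).1 z =
      ∑ i, ∑ I ∈ multiIndices n k, z.2 (i, I) * (fiberAverage (partialPhi i I f)).1 z :=
    (map_sum (evalAt z) _ _).trans
      (Finset.sum_congr rfl fun i _ => pairing_onCoeffs_linearization_apply hf i z)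
  set y := truncate n m k z with hy
  have hderiv : ∀ t : ℝ, HasDerivAt (fun t : ℝ => g (y.1, t • y.2))
      (fderiv ℝ g (y.1, t • y.2) (0, y.2)) t := fun t =>
    ((hg.differentiable (by simp)) (y.1, t • y.2)).hasFDerivAt.comp_hasDerivAt t
      ((hasDerivAt_const t y.1).prodMk (by simpa using (hasDerivAt_id t).smul_const y.2))
  have hdir : ((0, y.2) : FiniteJet n m k) =
      ∑ i, ∑ I ∈ multiIndices n k, z.2 (i, I) • truncate n m k (0, Pi.single (i, I) 1) := by
    refine Prod.ext ?_ (funext fun b => ?_)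
    · simp [truncate, Prod.fst_sum]
    · simp only [truncate, Prod.snd_sum, Prod.smul_snd, LinearMap.coe_mk, AddHom.coe_mk,
        Finset.sum_apply, Pi.smul_apply, smul_eq_mul]
      rw [Finset.sum_eq_single b.1, Finset.sum_eq_single (b.2 : MultiIndex n)]
      · rw [Pi.single_eq_same, mul_one]
        rfl
      · intro I _ hI
        rw [Pi.single_eq_of_ne, mul_zero]
        exact fun h => hI (congrArg (fun b => b.2) h).symm
      · exact fun h => absurd b.2.2 h
      · intro i _ hi
        refine Finset.sum_eq_zero fun I _ => ?_
        rw [Pi.single_eq_of_ne, mul_zero]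
        exact fun h => hi (congrArg (fun b => b.1) h).symm
      · exact fun h => absurd (Finset.mem_univ _) h
  have hint : ∀ t : ℝ, fderiv ℝ g (y.1, t • y.2) (0, y.2) =
      ∑ i, ∑ I ∈ multiIndices n k, z.2 (i, I) * (partialPhi i I f).1 (z.1, t • z.2) := by
    intro t
    rw [hdir, map_sum]
    refine Finset.sum_congr rfl fun i _ => ?_
    rw [map_sum]
    refine Finset.sum_congr rfl fun I _ => ?_
    rw [map_smul, smul_eq_mul]
    congr 1
    exact (directional_apply hg hfg (0, Pi.single (i, I) 1) (z.1, t • z.2)).symm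
  have hcont : Continuous fun t : ℝ => fderiv ℝ g (y.1, t • y.2) (0, y.2) := by
    rw [funext hint]
    exact continuous_finsetSum _ fun i _ => continuous_finsetSum _ fun I _ =>
      continuous_const.mul (continuous_scale _ z)
  have hftc := intervalIntegral.integral_eq_sub_of_hasDerivAt (a := 0) (b := 1)
    (fun t _ => hderiv t) (hcont.intervalIntegrable _ _)
  have h1 : g (y.1, (1 : ℝ) • y.2) = f.1 z := by
    rw [one_smul, hfg]
  have h0 : g (y.1, (0 : ℝ) • y.2) = f.1 (z.1, 0) := by
    rw [zero_smul, hfg]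
    rfl
  rw [h1, h0, funext hint, intervalIntegral.integral_finsetSum] at hftc
  · change f.1 z = f.1 (z.1, 0) + (∑ i, pairing i (onCoeffs fiberAverage (linearization i f))).1 z
    rw [hsum, ← sub_eq_iff_eq_add', ← hftc]
    refine Finset.sum_congr rfl fun i _ => ?_
    rw [intervalIntegral.integral_finsetSum]
    · exact Finset.sum_congr rfl fun I _ => intervalIntegral.integral_const_mul _ _
    · exact fun I _ => (continuous_const.mul (continuous_scale _ z)).intervalIntegrable _ _
  · exact fun i _ => (continuous_finsetSum _ fun I _ =>
      continuous_const.mul (continuous_scale _ z)).intervalIntegrable _ _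

/-- The homotopy formula `f = f|_{φ = 0} + ∑_{i, J} ∂_J (φ^i ∫₀¹ E^J_i(f)(x, tφ) dt)` with the
higher Euler operators `E^J_i`. -/
theorem eq_zeroSection_add_sum_opPow (f : LocalFunction n m) :
    f = zeroSection f + ∑ i, (higherEuler i f).sum fun J b =>
      opPow totalDeriv J (phi i 0 * fiberAverage b) := by
  conv_lhs => rw [eq_zeroSection_add_pairing f]
  congr 1
  refine Finset.sum_congr rfl fun i _ => ?_
  rw [← substitute_higherEuler i f, ← substitute_onCoeffs (commute_plusOp commute_totalDeriv)
    (commute_onCoeffs_plusOp commute_fiberAverage_totalDeriv), pairing_substitute]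
  exact Finsupp.sum_mapRange_index (hf := map_zero fiberAverage) fun J => by rw [mul_zero, map_zero]

/-! ### Functions of the base coordinates -/

/-- Integration in the direction of `x^r`. -/
theorem exists_base_primitive (r : Fin n) {β : (Fin n → ℝ) → ℝ} (hβ : ContDiff ℝ ∞ β) :
    ∃ γ : (Fin n → ℝ) → ℝ, ContDiff ℝ ∞ γ ∧ (∀ x, fderiv ℝ γ x (Pi.single r 1) = β x) ∧
      ∀ s, s ≠ r → (∀ x, fderiv ℝ β x (Pi.single s 1) = 0) →
        ∀ x, fderiv ℝ γ x (Pi.single s 1) = 0 := by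
  -- `P t` multiplies the coordinate `x^r` by `t`.
  let R : (Fin n → ℝ) →L[ℝ] (Fin n → ℝ) :=
    (ContinuousLinearMap.proj r : (Fin n → ℝ) →L[ℝ] ℝ).smulRight (Pi.single r (1 : ℝ))
  let P : ℝ → (Fin n → ℝ) →L[ℝ] (Fin n → ℝ) := fun t =>
    ContinuousLinearMap.id ℝ _ + (t - 1) • R
  have hP : ∀ t x, P t x = x + (t - 1) • R x := fun t x => rfl
  have hR : ∀ x, R x = x r • Pi.single r 1 := fun x => rfl
  have hH : ContDiff ℝ ∞ (Function.uncurry fun (x : Fin n → ℝ) (t : ℝ) => β (P t x)) := by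
    refine hβ.comp ?_
    simp only [hP]
    fun_prop
  have hDβ : Continuous (fderiv ℝ β) := hβ.continuous_fderiv (by simp)
  have hPc : ∀ x, Continuous fun t => P t x := fun x => by
    simp only [hP]
    fun_prop
  have hfd : ∀ t x v, fderiv ℝ (fun y => β (P t y)) x v = fderiv ℝ β (P t x) (P t v) := by
    intro t x v
    have h := ((hβ.differentiable (by simp)) (P t x)).hasFDerivAt.comp x (P t).hasFDerivAt
    exact congrArg (fun L => L v) h.fderiv
  let γ : (Fin n → ℝ) → ℝ := fun x => x r * ∫ t in (0 : ℝ)..1, β (P t x)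
  have hγ : ∀ x v, fderiv ℝ γ x v = v r * (∫ t in (0 : ℝ)..1, β (P t x)) +
      x r * ∫ t in (0 : ℝ)..1, fderiv ℝ β (P t x) (P t v) := by
    intro x v
    have h1 := ((ContinuousLinearMap.proj r : (Fin n → ℝ) →L[ℝ] ℝ).hasFDerivAt (x := x)).mul
      (hasFDerivAt_integral_parameter hH x)
    have h2 : fderiv ℝ γ x = _ := h1.fderiv
    have h3 : (∫ t in (0 : ℝ)..1, fderiv ℝ (fun y => β (P t y)) x) v =
        ∫ t in (0 : ℝ)..1, fderiv ℝ β (P t x) (P t v) := by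
      rw [ContinuousLinearMap.intervalIntegral_apply]
      · exact intervalIntegral.integral_congr fun t _ => hfd t x v
      · refine Continuous.intervalIntegrable ?_ _ _
        exact (contDiff_fderiv_parameter hH).continuous.comp
          (Continuous.prodMk continuous_const continuous_id)
    rw [h2, ← h3]
    simp only [add_apply, smul_apply, smul_eq_mul, ContinuousLinearMap.proj_apply]
    ring
  refine ⟨γ, ?_, fun x => ?_, fun s hs h x => ?_⟩
  · exact (contDiff_apply ℝ ℝ r).mul (contDiff_integral_parameter hH)
  · have hPr : ∀ t, P t (Pi.single r 1) = t • Pi.single r (1 : ℝ) := fun t => by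
      rw [hP, hR, Pi.single_eq_same, one_smul, sub_smul, one_smul, add_sub_cancel]
    have hPd : ∀ t, HasDerivAt (fun t => P t x) (R x) t := fun t => by
      simpa [hP] using (((hasDerivAt_id t).sub_const 1).smul_const (R x)).const_add x
    -- The integrand is the derivative of `t β(P t x)`.
    have hd : ∀ t : ℝ, HasDerivAt (fun t => t * β (P t x))
        (β (P t x) + x r * fderiv ℝ β (P t x) (P t (Pi.single r 1))) t := by
      intro t
      have h := (hasDerivAt_id t).mul
        (((hβ.differentiable (by simp)) (P t x)).hasFDerivAt.comp_hasDerivAt t (hPd t))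
      refine h.congr_deriv ?_
      rw [hPr, hR, map_smul, map_smul]
      simp only [id, smul_eq_mul, Function.comp_apply]
      ring
    have hc1 : Continuous fun t => β (P t x) := hβ.continuous.comp (hPc x)
    have hc2 : Continuous fun t => fderiv ℝ β (P t x) (P t (Pi.single r 1)) :=
      (hDβ.comp (hPc x)).clm_apply (hPc _)
    have hftc := intervalIntegral.integral_eq_sub_of_hasDerivAt (a := 0) (b := 1)
      (fun t _ => hd t) ((hc1.add (continuous_const.mul hc2)).intervalIntegrable _ _)
    rw [intervalIntegral.integral_add (hc1.intervalIntegrable _ _)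
      ((hc2.const_mul (x r)).intervalIntegrable _ _),
      intervalIntegral.integral_const_mul] at hftc
    rw [hγ, Pi.single_eq_same, one_mul, hftc, hP]
    simp
  · have hPs : ∀ t, P t (Pi.single s 1) = Pi.single s (1 : ℝ) := fun t => by
      rw [hP, hR, Pi.single_eq_of_ne hs.symm, zero_smul, smul_zero, add_zero]
    rw [hγ, Pi.single_eq_of_ne hs.symm]
    simp [hPs, h]

/-! ### Regularity of the total derivatives -/

theorem opPow_totalDeriv_mem_rangeBelow {J : MultiIndex n} {r : ℕ} {s : Fin n} (hs : s.1 < r)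
    (hJ : J s ≠ 0) (f : LocalFunction n m) :
    opPow totalDeriv J f ∈ rangeBelow (totalDeriv (m := m)) r := by
  obtain ⟨I, rfl⟩ := MultiIndex.exists_append hJ
  rw [opPow_append commute_totalDeriv]
  exact apply_mem_rangeBelow _ hs _

/-- A local function is a divergence in the directions `s < r` if and only if its higher Euler
derivatives of all orders `J` without an index `s < r` vanish. -/
theorem mem_rangeBelow_iff {r : ℕ} (hr : 0 < r) (hn : 0 < n) (f : LocalFunction n m) :
    f ∈ rangeBelow (totalDeriv (m := m)) r ↔
      ∀ (i : Fin m) (J : MultiIndex n), (∀ s : Fin n, s.1 < r → J s = 0) →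
        higherEuler i f J = 0 := by
  constructor
  · intro h i J hJ
    have hle : rangeBelow (totalDeriv (m := m)) r ≤
        LinearMap.ker (Finsupp.lapply J ∘ₗ higherEuler i) := by
      refine iSup_le fun s => ?_
      rintro _ ⟨a, rfl⟩
      rw [LinearMap.mem_ker]
      by_cases hs : s.1 < r
      · rw [initial, if_pos hs, LinearMap.comp_apply, higherEuler_totalDeriv]
        exact mulX_apply_of_eq_zero (hJ s hs) _
      · rw [initial, if_neg hs, LinearMap.zero_apply, map_zero]
    exact hle h
  · intro h
    rw [eq_zeroSection_add_sum_opPow f]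
    refine Submodule.add_mem _ ?_
      (Submodule.sum_mem _ fun i _ => Submodule.sum_mem _ fun J hJ => ?_)
    · obtain ⟨γ, hγ, h1, -⟩ := exists_base_primitive ⟨0, hn⟩ (contDiff_zeroSection f)
      have h2 : totalDeriv ⟨0, hn⟩ (ofBase γ hγ) = zeroSection f :=
        localFunction_ext fun z => (totalDeriv_ofBase_apply hγ _ z).trans (h1 z.1)
      rw [← h2]
      exact apply_mem_rangeBelow _ hr _
    · obtain ⟨s, hs, hJs⟩ : ∃ s : Fin n, s.1 < r ∧ J s ≠ 0 := by
        by_contra! h0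
        exact (Finsupp.mem_support_iff.1 hJ) (h i J h0)
      exact opPow_totalDeriv_mem_rangeBelow hs hJs _

theorem totalDeriv_regular (r : Fin n) (hr : 0 < r.1) (f : LocalFunction n m)
    (h : totalDeriv r f ∈ rangeBelow (totalDeriv (m := m)) r) :
    f ∈ rangeBelow (totalDeriv (m := m)) r := by
  rw [mem_rangeBelow_iff hr r.pos] at h ⊢
  intro i J hJ
  have h1 := h i (J.append r) fun s hs => by
    rw [MultiIndex.append_apply_of_ne _ (Fin.ne_of_lt hs), hJ s hs]
  rwa [higherEuler_totalDeriv, mulX_apply_append] at h1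

/-- A local function annihilated by a total derivative only depends on the base coordinates. -/
theorem eq_zeroSection_of_totalDeriv_eq_zero {s : Fin n} {f : LocalFunction n m}
    (h : totalDeriv s f = 0) : f = zeroSection f := by
  have h0 : ∀ i, higherEuler i f = 0 := fun i => Finsupp.ext fun J => by
    rw [← mulX_apply_append s, ← higherEuler_totalDeriv, h, map_zero]
    rfl
  have h1 := eq_zeroSection_add_sum_opPow f
  simpa only [h0, Finsupp.sum_zero_index, Finset.sum_const_zero, add_zero] using h1

theorem totalDeriv_coregular (r : Fin n) (hr : 0 < r.1) (b : LocalFunction n m)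
    (h : ∀ s, s < r → totalDeriv s b = 0) :
    ∃ c : LocalFunction n m, totalDeriv r c = b ∧ ∀ s, s < r → totalDeriv s c = 0 := by
  have hb := eq_zeroSection_of_totalDeriv_eq_zero (h ⟨0, r.pos⟩ hr)
  obtain ⟨γ, hγ, h1, h2⟩ := exists_base_primitive r (contDiff_zeroSection b)
  refine ⟨ofBase γ hγ, ?_, fun s hs => localFunction_ext fun z => ?_⟩
  · rw [hb]
    exact localFunction_ext fun z => (totalDeriv_ofBase_apply hγ _ z).trans (h1 z.1)
  · refine (totalDeriv_ofBase_apply hγ _ z).trans (h2 s (ne_of_lt hs) (fun x => ?_) z.1)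
    rw [← totalDeriv_ofBase_apply (m := m) (contDiff_zeroSection b) s (x, 0)]
    have h3 := h s hs
    rw [hb] at h3
    exact congrArg (fun f => f.1 (x, 0)) h3

theorem eq_const_of_totalDeriv_eq_zero (hn : 0 < n) {f : LocalFunction n m}
    (h : ∀ s, totalDeriv s f = 0) : f = algebraMap ℝ (LocalFunction n m) (f.1 0) := by
  have hf := eq_zeroSection_of_totalDeriv_eq_zero (h ⟨0, hn⟩)
  have hd : ∀ x, fderiv ℝ (fun x => f.1 (x, 0)) x = 0 := fun x => by
    refine ContinuousLinearMap.coe_injective ((Pi.basisFun ℝ (Fin n)).ext fun s => ?_)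
    have h1 := h s
    rw [hf] at h1
    have h2 := (totalDeriv_ofBase_apply (m := m) (contDiff_zeroSection f) s (x, 0)).symm.trans
      (congrArg (fun f => f.1 (x, 0)) h1)
    simpa using h2
  refine localFunction_ext fun z => ?_
  have h1 : f.1 z = f.1 (z.1, 0) := congrArg (fun f => f.1 z) hf
  rw [h1]
  exact is_const_of_fderiv_eq_zero ((contDiff_zeroSection f).differentiable (by simp)) hd z.1 0

end FiberContraction

/-! ### Cohomology of the horizontal complex -/

section HorizontalCohomology

variable {n m : ℕ}

theorem initial_self {A : Type*} [AddCommGroup A] [Module ℝ A] (D : Fin n → Module.End ℝ A) :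
    initial D n = D :=
  funext fun μ => if_pos μ.2

theorem dH_eq_koszulD {p : ℕ} (ω : HorizontalForm n m p) :
    dH n m p ω = koszulD (initial totalDeriv n) ω := by
  rw [initial_self]
  rfl

theorem involves_self {A : Type*} [AddCommGroup A] [Module ℝ A] {p : ℕ} (ω : Form n A p) :
    Involves n ω := by
  cases p with
  | zero => trivial
  | succ p => exact fun μ hμ => absurd μ.2 (not_lt.2 hμ)

theorem mem_cocycles_zero_iff (hn : 0 < n) {ω : HorizontalForm n m 0} :
    ω ∈ cocycles n m 0 ↔ ∃ c, ω = constForm n m c := by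
  constructor
  · intro h
    have hω : koszulD totalDeriv ω = 0 := h
    have h1 : ∀ s, totalDeriv s (ω ![]) = 0 := fun s => by
      have h2 := congrArg (fun θ => contract s θ ![]) hω
      simp only [contract_koszulD_zero] at h2
      exact h2
    exact ⟨_, form_zero_ext (eq_const_of_totalDeriv_eq_zero hn h1)⟩
  · rintro ⟨c, rfl⟩
    change koszulD totalDeriv (constForm n m c) = 0
    refine form_ext fun s => ?_
    rw [contract_koszulD_zero]
    refine form_zero_ext (localFunction_ext fun z => ?_)
    refine (totalDeriv_ofBase_apply (β := fun _ => c) contDiff_const s z).trans ?_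
    rw [fderiv_fun_const]
    rfl

theorem cocycles_le_coboundaries {p : ℕ} (h0 : 0 < p) (hp : p < n) :
    cocycles n m p ≤ coboundaries n m p := by
  obtain ⟨p, rfl⟩ : ∃ q, p = q + 1 := ⟨p - 1, by omega⟩
  intro ω hω
  have hd : koszulD (initial totalDeriv n) ω = 0 := (dH_eq_koszulD ω).symm.trans hω
  obtain ⟨η, -, hη⟩ := koszul_exact totalDeriv_comm totalDeriv_regular totalDeriv_coregular le_rfl
    hp (involves_self ω) hd
  exact ⟨η, (dH_eq_koszulD η).trans hη⟩

theorem cocycles_top : cocycles n m n = ⊤ := by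
  refine eq_top_iff.2 fun ω _ => ?_
  exact Involves.eq_zero (A := LocalFunction n m) le_rfl (Nat.lt_succ_self n) (involves_self _)

/-- The two orderings of the basis of `ℝⁿ` give the same coefficient up to a sign. -/
theorem topCoeff_eq_sign_smul_density (ω : HorizontalForm n m n) :
    topCoeff le_rfl ω = Equiv.Perm.sign (Fin.revPerm : Equiv.Perm (Fin n)) • density ω := by
  change _ = _ • ω fun μ => Pi.single μ 1
  rw [← ω.map_perm, topCoeff]
  congr 1
  funext j
  simp only [Function.comp_apply, Fin.revPerm_apply]
  congr 1
  refine Fin.ext ?_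
  simp only [Fin.val_rev]
  omega

theorem mem_coboundaries_top_iff (hn : 0 < n) (ω : HorizontalForm n m n) :
    ω ∈ coboundaries n m n ↔ ∀ i, eulerLagrange i (density ω) = 0 := by
  have h1 : ω ∈ coboundaries n m n ↔
      topCoeff le_rfl ω ∈ rangeBelow (totalDeriv (m := m)) n := by
    obtain ⟨n, rfl⟩ : ∃ q, n = q + 1 := ⟨n - 1, by omega⟩
    constructor
    · rintro ⟨η, rfl⟩
      rw [dH_eq_koszulD]
      exact topCoeff_koszulD_mem _ le_rfl _ _
    · intro h
      obtain ⟨η, -, hη⟩ := exact_of_topCoeff_mem le_rfl (involves_self ω) h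
      exact ⟨η, (dH_eq_koszulD η).trans hη⟩
  rw [h1, mem_rangeBelow_iff hn hn, topCoeff_eq_sign_smul_density]
  refine forall_congr' fun i => ?_
  have h2 : ∀ J : MultiIndex n, (∀ s : Fin n, s.1 < n → J s = 0) ↔ J = 0 := fun J =>
    ⟨fun h => funext fun s => h s s.2, fun h s _ => congrFun h s⟩
  simp only [h2, forall_eq, higherEuler_apply_zero]
  rcases Int.units_eq_one_or (Equiv.Perm.sign (Fin.revPerm : Equiv.Perm (Fin n))) with h | h
  · rw [h, one_smul]
  · rw [h, Units.neg_smul, one_smul, map_neg, neg_eq_zero]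

end HorizontalCohomology

end HorizontalComplex

end

theorem mainTheorem1 (n m : ℕ) (hn : 0 < n) :
    (∃ e : HorizontalComplex.Cohomology n m 0 ≃ₗ[ℝ] ℝ,
      ∀ c : ℝ, ∃ hc : HorizontalComplex.constForm n m c ∈ HorizontalComplex.cocycles n m 0,
        e (HorizontalComplex.cohomologyClass ⟨HorizontalComplex.constForm n m c, hc⟩) = c) ∧
    (∀ p : ℕ, 0 < p → p < n → Subsingleton (HorizontalComplex.Cohomology n m p)) ∧
    (HorizontalComplex.cocycles n m n = ⊤ ∧
      (∀ ω ω' : HorizontalComplex.HorizontalForm n m n,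
        ω - ω' ∈ HorizontalComplex.coboundaries n m n ↔
          ∀ i : Fin m, HorizontalComplex.eulerLagrange i
            (HorizontalComplex.density (ω - ω')) = 0) ∧
      ∃ e : HorizontalComplex.Cohomology n m n ≃ₗ[ℝ]
          HorizontalComplex.HorizontalForm n m n ⧸
            LinearMap.ker (HorizontalComplex.eulerLagrangeTop n m),
        ∀ ω : HorizontalComplex.cocycles n m n,
          e (HorizontalComplex.cohomologyClass ω) =
            Submodule.Quotient.mk (ω : HorizontalComplex.HorizontalForm n m n)) := by
  open HorizontalComplex in
  refine ⟨?_, fun p h0 hp => ?_, cocycles_top, fun ω ω' => mem_coboundaries_top_iff hn _, ?_⟩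
  · have hc : ∀ c, constForm n m c ∈ cocycles n m 0 := fun c =>
      (mem_cocycles_zero_iff hn).2 ⟨c, rfl⟩
    let ψ : ℝ →ₗ[ℝ] Cohomology n m 0 := cohomologyClass ∘ₗ
      { toFun := fun c => ⟨constForm n m c, hc c⟩
        map_add' := fun a b => Subtype.ext (form_zero_ext (map_add (algebraMap ℝ _) a b))
        map_smul' := fun a b => Subtype.ext (form_zero_ext
          ((algebraMap ℝ (LocalFunction n m)).map_mul a b)) }
    have hψ : Function.Bijective ψ := by
      constructor
      · refine (injective_iff_map_eq_zero ψ).2 fun c h => ?_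
        have h1 : constForm n m c ∈ (⊥ : Submodule ℝ (HorizontalForm n m 0)) :=
          (Submodule.Quotient.mk_eq_zero
            ((coboundaries n m 0).submoduleOf (cocycles n m 0))).1 h
        have h2 : constForm n m c = 0 := (Submodule.mem_bot ℝ).1 h1
        exact congrArg (fun ω : HorizontalForm n m 0 => (ω ![]).1 0) h2
      · intro x
        obtain ⟨⟨ω, hω⟩, rfl⟩ := Submodule.Quotient.mk_surjective _ x
        obtain ⟨c, rfl⟩ := (mem_cocycles_zero_iff hn).1 hω
        exact ⟨c, rfl⟩
    exact ⟨(LinearEquiv.ofBijective ψ hψ).symm, fun c =>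
      ⟨hc c, (LinearEquiv.ofBijective ψ hψ).symm_apply_apply c⟩⟩
  · exact Submodule.Quotient.subsingleton_iff.2
      (eq_top_iff.2 fun ω _ => cocycles_le_coboundaries h0 hp ω.2)
  · refine ⟨Submodule.Quotient.equiv _ _ (LinearEquiv.ofTop _ cocycles_top) ?_, fun ω => rfl⟩
    ext ω
    have h1 : ω ∈ LinearMap.ker (eulerLagrangeTop n m) ↔ ω ∈ coboundaries n m n := by
      rw [mem_coboundaries_top_iff hn, LinearMap.mem_ker]
      exact funext_iff
    rw [h1]
    constructor
    · rintro ⟨θ, hθ, rfl⟩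
      exact hθ
    · exact fun h => ⟨⟨ω, cocycles_top.ge trivial⟩, h, rfl⟩
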